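/- **Setting.** Let $\Lambda\subset J^1(S^1)=S^1_x\times\mathbb{R}^2_{y,z}$, with contact structure $\ker(dz-y\,dx)$, be an oriented Legendrian link, given by a generic front diagram in the $xz$-cylinder. Cut the front at slices $x_0,\dots,x_{M-1}$, cyclically ordered with $x_M=x_0$, so that between consecutive slices there is at most one crossing or cusp. Let $N(m)$ be the number of strands at $x_m$, numbered $1,\dots,N(m)$ from top to bottom. A *generalized normal ruling* is a family of involutions $\sigma_m$ of $\{1,\dots,N(m)\}$ for all $m$, with $\sigma_M=\sigma_0$, such that: $\sigma_m=\sigma_{m-1}$ if there is no crossing or cusp between $x_{m-1}$ and $x_m$; at a left or right cusp of strands $\ell,\ell+1$ the involution pairs $\ell$ with $\ell+1$ on the side where these strands exist, and is otherwise unchanged up to the renumbering of the strands; at a crossing of strands $\ell,\ell+1$ we have $\sigma_{m-1}(\ell)\ne\ell+1$, and either $\sigma_m=(\ell\ \,\ell{+}1)\circ\sigma_{m-1}\circ(\ell\ \,\ell{+}1)$, or $\sigma_m=\sigma_{m-1}$ (a switch) and one of $$\sigma_m(\ell+1)<\sigma_m(\ell)<\ell,\qquad \sigma_m(\ell)<\ell<\ell+1<\sigma_m(\ell+1),\qquad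 \ell+1<\sigma_m(\ell+1)<\sigma_m(\ell),$$ $$\sigma_m(\ell)=\ell<\ell+1<\sigma_m(\ell+1),\qquad \sigma_m(\ell)<\ell<\ell+1=\sigma_m(\ell+1)$$ holds. It is *strictly generalized* if some $\sigma_m$ has a fixed point (a self-paired strand). Place $s$ base points, labelled $t_1,\dots,t_s$, on $\Lambda$ (on strands, or on the loops of resolved right cusps), at least one on each component, and fix a Maslov potential $\mu$ with values in $\mathbb{Z}/2r$, even exactly on the strands oriented to the right. Let $(\mathcal{A},\partial)$ be the Chekanov–Eliashberg DGA of the dipped diagram (the resolution of the front, with a dip at each slice): $\mathcal{A}$ is the tensor algebra over $\mathbb{Z}[t_1^{\pm1},\dots,t_s^{\pm1}]$ generated by $a_m$ for each crossing or right cusp between $x_{m-1}$ and $x_m$, and by $b^m_{ij},c^m_{ij}$ for $1\le i<j\le N(m)$. Degrees are $|a_m|=\mu(\ell)-\mu(\ell+1)$ at a crossing of $\ell,\ell+1$ (potentials taken at $x_{m-1}$), $|a_m|=1$ at a right cusp, $|b^m_{ij}|=\mu(i)-\mu(j)$ and $|c^m_{ij}|=\mu(i)-\mu(j)-1$. With the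 strictly upper triangular matrices $B_m=(b^m_{ij})$, $C_m=(c^m_{ij})$ and $\Sigma_m=\mathrm{diag}((-1)^{\mu(i)})$, the differential is $$\partial C_m=(\Sigma_m C_m)^2,\qquad \partial B_m=-\Sigma_m(I+B_m)\Sigma_m C_m+\widetilde C_{m-1}(I+B_m),$$ extended by $\partial(xy)=(\partial x)y+(-1)^{|x|}x\,\partial y$ and $\partial t_q=0$. Here let $C'=\Delta C_{m-1}\Delta^{-1}$, where $\Delta$ is diagonal with $i$-th entry the product of $t_q^{-1}$ (strand $i$ oriented to the right) or $t_q$ (oriented to the left) over the base points $q$ on strand $i$ at $x_{m-1}$. If nothing happens between $x_{m-1}$ and $x_m$, then $\widetilde C_{m-1}=C'$. At a crossing of $\ell,\ell+1$, $\partial a_m=C'_{\ell,\ell+1}$ and $\widetilde C_{m-1}=U\widehat C V$, where $\widehat C$ is $C'$ with the entry at $(\ell,\ell+1)$ replaced by $0$, and $U,V$ are identity matrices with the blocks $\begin{pmatrix}0&1\\1&(-1)^{|a_m|+1}a_m\end{pmatrix}$, $\begin{pmatrix}a_m&1\\1&0\end{pmatrix}$ in rows and columns $\ell,\ell+1$.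 At a left cusp $\ell,\ell+1$, $\widetilde C_{m-1}$ is $C'$ with two new rows and columns $\ell,\ell+1$ that vanish except for the entry $1$ at $(\ell,\ell+1)$. At a right cusp $\ell,\ell+1$, $\partial a_m=\tau+C'_{\ell,\ell+1}$, where $\tau$ is the product of the $t_q$ ($t_q^{-1}$ if strand $\ell$ is oriented to the left) over the base points on the loop, and $\widetilde C_{m-1}$ has the entries $$C'_{ij}+\tau^{-1}(C'_{i,\ell+1}+C'_{i\ell}a_m)(C'_{\ell j}+a_mC'_{\ell+1,j}),\qquad i,j\notin\{\ell,\ell+1\}$$ (the second summand vanishes if the cusp joins the two lowest strands). An *augmentation* of $(\mathcal{A},\partial)$ to a field $F$ is a unital ring homomorphism $\epsilon:\mathcal{A}\to F$ with $\epsilon\circ\partial=0$. **Proposition.** If the front of $\Lambda$ has a strictly generalized normal ruling and $F$ is a field, then for every $0\ne x\in F$ there is an augmentation $\epsilon:\mathcal{A}\to F$ with $\epsilon(t_1\cdots t_s)=x$. -/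

import Mathlib

/-!
Legendrian links in `J¹(S¹)` through their front diagrams, generalized normal rulings, and the
Chekanov-Eliashberg DGA over `ℤ[t₁^{±1}, …, t_s^{±1}]` of the dipped diagram.

Strands over a slice of the front are numbered from top to bottom, starting with `0`.
-/

namespace SolidTorus

/-! ### Front diagrams -/

/-- The elementary tangles of a front, from `n` strands on the left to `n'` strands on the right.
A crossing or a cusp at `k` involves the neighbouring strands `k` (`Fin.castSucc k`) and `k + 1`
(`Fin.succ k`). `trivial` is a slab without crossing or cusp; it is needed for fronts that have
neither. -/
inductive Event : ℕ → ℕ → Type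
  | trivial (n : ℕ) : Event n n
  | crossing (n : ℕ) (k : Fin (n + 1)) : Event (n + 2) (n + 2)
  | leftCusp (n : ℕ) (k : Fin (n + 1)) : Event n (n + 2)
  | rightCusp (n : ℕ) (k : Fin (n + 1)) : Event (n + 2) n

/-- The increasing map `Fin n → Fin (n + 2)` that misses exactly `k` and `k + 1`. -/
def skip {n : ℕ} (k : Fin (n + 1)) (i : Fin n) : Fin (n + 2) :=
  k.succ.succAbove (k.succAbove i)

/-- The transposition `(k  k+1)`. -/
def transp {n : ℕ} (k : Fin (n + 1)) : Equiv.Perm (Fin (n + 2)) :=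
  Equiv.swap k.castSucc k.succ

namespace Event

/-- Strand `i` on the left and strand `j` on the right of the event are connected through it. -/
def Through : {n n' : ℕ} → Event n n' → Fin n → Fin n' → Prop
  | _, _, trivial _, i, j => j = i
  | _, _, crossing _ k, i, j => j = transp k i
  | _, _, leftCusp _ k, i, j => j = skip k i
  | _, _, rightCusp _ k, i, j => i = skip k j

/-- The event is a left cusp, born with upper strand `i` and lower strand `j`. -/
def LeftCuspAt : {n n' : ℕ} → Event n n' → Fin n' → Fin n' → Prop
  | _, _, leftCusp _ k, i, j => i = k.castSucc ∧ j = k.succ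
  | _, _, _, _, _ => False

/-- The event is a right cusp, ending the upper strand `i` and the lower strand `j`. -/
def RightCuspAt : {n n' : ℕ} → Event n n' → Fin n → Fin n → Prop
  | _, _, rightCusp _ k, i, j => i = k.castSucc ∧ j = k.succ
  | _, _, _, _, _ => False

/-- The event gives a crossing of the resolved diagram: it is a crossing or a right cusp. -/
def HasGenerator : {n n' : ℕ} → Event n n' → Prop
  | _, _, crossing _ _ => True
  | _, _, rightCusp _ _ => True
  | _, _, _ => False

end Event

/-- A front diagram in `S¹ × ℝ`, cut into slabs with at most one crossing or cusp each.
There are `M + 1` slices, numbered cyclically by `Fin (M + 1)`; there are `N m` strands over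
slice `m`, and `event m` lies between slice `m` and slice `m + 1`. -/
structure Front where
  M : ℕ
  N : Fin (M + 1) → ℕ
  event : (m : Fin (M + 1)) → Event (N m) (N (m + 1))

namespace Front

/-- The strands over the slices. -/
abbrev Strand (D : Front) : Type := Σ m : Fin (D.M + 1), Fin (D.N m)

/-- Two pieces of strand that are adjacent on the link. -/
inductive Adj (D : Front) : D.Strand → D.Strand → Prop
  | through (m : Fin (D.M + 1)) (i : Fin (D.N m)) (j : Fin (D.N (m + 1))) :
      (D.event m).Through i j → Adj D ⟨m, i⟩ ⟨m + 1, j⟩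
  | left (m : Fin (D.M + 1)) (i j : Fin (D.N (m + 1))) :
      (D.event m).LeftCuspAt i j → Adj D ⟨m + 1, i⟩ ⟨m + 1, j⟩
  | right (m : Fin (D.M + 1)) (i j : Fin (D.N m)) :
      (D.event m).RightCuspAt i j → Adj D ⟨m, i⟩ ⟨m, j⟩

/-- Two strands belong to the same component of the link. -/
def SameComponent (D : Front) : D.Strand → D.Strand → Prop :=
  Relation.EqvGen D.Adj

/-- A Maslov potential with values in `ℤ / 2r`. It also fixes the orientation of the link: a strand
is oriented to the right if its potential is even, and to the left if it is odd. -/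
structure MaslovPotential (D : Front) (r : ℕ) where
  val : (m : Fin (D.M + 1)) → Fin (D.N m) → ZMod (2 * r)
  through : ∀ m i j, (D.event m).Through i j → val (m + 1) j = val m i
  left : ∀ m i j, (D.event m).LeftCuspAt i j → val (m + 1) i = val (m + 1) j + 1
  right : ∀ m i j, (D.event m).RightCuspAt i j → val m i = val m j + 1

/-- The places for a base point: on a strand `i` at slice `m` (to the right of the dip there and
to the left of `event m`), or on the loop of the resolution of a right cusp `event m` with upper
strand `i` and lower strand `j`. -/
inductive Site (D : Front) : Type
  | strand (m : Fin (D.M + 1)) (i : Fin (D.N m)) : Site D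
  | loop (m : Fin (D.M + 1)) (i j : Fin (D.N m)) (h : (D.event m).RightCuspAt i j) : Site D

/-- A strand on the component that a site lies on. -/
def Site.toStrand {D : Front} : D.Site → D.Strand
  | strand m i => ⟨m, i⟩
  | loop m i _ _ => ⟨m, i⟩

/-- `s` base points, at least one on each component of the link. -/
structure BasePoints (D : Front) (s : ℕ) where
  pos : Fin s → D.Site
  exists_mem : ∀ p : D.Strand, ∃ q : Fin s, D.SameComponent p (pos q).toStrand

end Front

/-! ### Generalized normal rulings -/

/-- The normality condition at a switched crossing of the strands `k` and `k + 1`. The first three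
cases are those of two paired crossing strands, the last two those of exactly one self-paired
crossing strand. -/
def Normality {n : ℕ} (k : Fin (n + 1)) (σ : Fin (n + 2) → Fin (n + 2)) : Prop :=
  (σ k.succ < σ k.castSucc ∧ σ k.castSucc < k.castSucc) ∨
  (σ k.castSucc < k.castSucc ∧ k.succ < σ k.succ) ∨
  (k.succ < σ k.succ ∧ σ k.succ < σ k.castSucc) ∨
  (σ k.castSucc = k.castSucc ∧ k.succ < σ k.succ) ∨
  (σ k.castSucc < k.castSucc ∧ σ k.succ = k.succ)

/-- The condition of a generalized normal ruling on the involutions `σ` to the left and `σ'` to the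
right of an event. -/
def Event.RulingStep : {n n' : ℕ} → Event n n' → (Fin n → Fin n) → (Fin n' → Fin n') → Prop
  | _, _, .trivial _, σ, σ' => σ' = σ
  | _, _, .crossing _ k, σ, σ' =>
      σ k.castSucc ≠ k.succ ∧
        (σ' = transp k ∘ σ ∘ transp k ∨ (σ' = σ ∧ Normality k σ))
  | _, _, .leftCusp _ k, σ, σ' =>
      σ' k.castSucc = k.succ ∧ ∀ i, σ' (skip k i) = skip k (σ i)
  | _, _, .rightCusp _ k, σ, σ' =>
      σ k.castSucc = k.succ ∧ ∀ i, σ (skip k i) = skip k (σ' i)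

/-- Generalized normal rulings of a front in `J¹(S¹)`. -/
structure Front.GeneralizedNormalRuling (D : Front) where
  σ : (m : Fin (D.M + 1)) → Fin (D.N m) → Fin (D.N m)
  involutive : ∀ m, Function.Involutive (σ m)
  step : ∀ m, (D.event m).RulingStep (σ m) (σ (m + 1))

/-- A strictly generalized normal ruling has a self-paired strand. -/
def Front.GeneralizedNormalRuling.IsStrict {D : Front} (R : D.GeneralizedNormalRuling) : Prop :=
  ∃ (m : Fin (D.M + 1)) (i : Fin (D.N m)), R.σ m i = i

/-! ### Coefficients, and differentials on free algebras -/

/-- The Laurent polynomial ring `ℤ[t₁^{±1}, …, t_s^{±1}]`. -/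
abbrev Laurent (s : ℕ) : Type := AddMonoidAlgebra ℤ (Fin s → ℤ)

/-- The monomial `t₁^{v₁} ⋯ t_s^{v_s}`. -/
noncomputable def mono {s : ℕ} (v : Fin s → ℤ) : Laurent s := AddMonoidAlgebra.single v 1

/-- The variable `t_q`. -/
noncomputable def tVar {s : ℕ} (q : Fin s) : Laurent s := mono (Pi.single q 1)

/-- The sign `(-1)^d` of a degree `d ∈ ℤ / 2r`. -/
def sgn {r : ℕ} (d : ZMod (2 * r)) : ℤ :=
  if ZMod.castHom (Dvd.intro r rfl) (ZMod 2) d = 0 then 1 else -1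

section FreeDifferential

variable {R X : Type} [CommRing R] (sg : X → ℤ) (d : X → FreeAlgebra R X)

/-- The algebra map sending a generator `g` to `[[sg g • g, d g], [0, g]]`. -/
noncomputable def leibnizHom :
    FreeAlgebra R X →ₐ[R] Matrix (Fin 2) (Fin 2) (FreeAlgebra R X) :=
  FreeAlgebra.lift R fun g =>
    !![sg g • FreeAlgebra.ι R g, d g; 0, FreeAlgebra.ι R g]

/-- The algebra automorphism `x ↦ (-1)^{|x|} x`, where `sg g = (-1)^{|g|}` on generators. -/
noncomputable def signMap : FreeAlgebra R X →ₐ[R] FreeAlgebra R X :=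
  FreeAlgebra.lift R fun g => sg g • FreeAlgebra.ι R g

/-- The extension of `d` from the generators to the free algebra by the signed Leibniz rule
`∂(xy) = (∂x) y + (-1)^{|x|} x (∂y)`, with `∂ = 0` on the coefficients; see the lemmas
`extend_ι`, `extend_algebraMap` and `extend_mul`. -/
noncomputable def extend (x : FreeAlgebra R X) : FreeAlgebra R X := leibnizHom sg d x 0 1

theorem leibnizHom_entries (x : FreeAlgebra R X) :
    leibnizHom sg d x 0 0 = signMap sg x ∧ leibnizHom sg d x 1 0 = 0 ∧
      leibnizHom sg d x 1 1 = x := by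
  induction x using FreeAlgebra.induction with
  | grade0 r => simp [Matrix.algebraMap_eq_diagonal]
  | grade1 g => simp [leibnizHom, signMap]
  | mul a b ha hb =>
      simp only [map_mul, Matrix.mul_apply, Fin.sum_univ_two, ha.1, ha.2.1, ha.2.2, hb.1, hb.2.1,
        hb.2.2]
      simp
  | add a b ha hb => simp [ha.1, ha.2.1, ha.2.2, hb.1, hb.2.1, hb.2.2]

theorem extend_ι (g : X) : extend sg d (FreeAlgebra.ι R g) = d g := by
  simp [extend, leibnizHom]

theorem extend_algebraMap (r : R) : extend sg d (algebraMap R (FreeAlgebra R X) r) = 0 := by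
  simp [extend, Matrix.algebraMap_eq_diagonal]

theorem extend_add (x y : FreeAlgebra R X) :
    extend sg d (x + y) = extend sg d x + extend sg d y := by
  simp [extend]

theorem extend_mul (x y : FreeAlgebra R X) :
    extend sg d (x * y) = extend sg d x * y + signMap sg x * extend sg d y := by
  simp only [extend, map_mul, Matrix.mul_apply, Fin.sum_univ_two, (leibnizHom_entries sg d x).1,
    (leibnizHom_entries sg d y).2.2]
  rw [add_comm]

end FreeDifferential

/-! ### The DGA of the dipped diagram -/

/-- The differential of the generator `a` at an event, where `C` is the matrix entering from the
left and `τ` is the monomial of the base points on the loop of a right cusp: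
`c_{k,k+1}` at a crossing, `τ + c_{k,k+1}` at a right cusp. -/
def Event.boundary {A : Type} [Ring A] (τ : A) :
    {n n' : ℕ} → Event n n' → Matrix (Fin n) (Fin n) A → A
  | _, _, .crossing _ k, C => C k.castSucc k.succ
  | _, _, .rightCusp _ k, C => τ + C k.castSucc k.succ
  | _, _, _, _ => 0

/-- The matrix `C̃` leaving an event to the right, where `C` is the matrix entering from the left,
`a` is the generator of the event, `sa = (-1)^{|a|}`, and `τ'` is the inverse of the monomial of
the base points on the loop of a right cusp.

* At a crossing, `C̃ = U Ĉ V`, where `Ĉ` is `C` with its entry at `(k, k+1)` replaced by `0`, and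
  `U`, `V` are the identity except for the blocks `[[0, 1], [1, -(-1)^{|a|} a]]` and
  `[[a, 1], [1, 0]]` in the rows and columns `k, k+1`.
* At a left cusp, two rows and columns are inserted, with the entry `1` at `(k, k+1)`.
* At a right cusp, the rows and columns `k, k+1` are removed. The further term counts the disks
  from a strand above to a strand below the cusp whose boundary runs around the loop; as `C` is
  strictly upper triangular, it vanishes if the cusp involves the two lowest strands. -/
def Event.outgoing {A : Type} [Ring A] (a : A) (sa : ℤ) (τ' : A) :
    {n n' : ℕ} → Event n n' → Matrix (Fin n) (Fin n) A → Matrix (Fin n') (Fin n') A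
  | _, _, .trivial _, C => C
  | _, _, .crossing _ k, C =>
      let p := k.castSucc
      let q := k.succ
      let Chat := C.updateRow p (Function.update (C p) q 0)
      let U : Matrix _ _ A := fun i j =>
        if i = p then (if j = q then 1 else 0)
        else if i = q then (if j = p then 1 else if j = q then -(sa • a) else 0)
        else if i = j then 1 else 0
      let V : Matrix _ _ A := fun i j =>
        if i = p then (if j = p then a else if j = q then 1 else 0)
        else if i = q then (if j = p then 1 else 0)
        else if i = j then 1 else 0
      U * Chat * V
  | _, _, .leftCusp n k, C =>
      let J : Matrix (Fin (n + 2)) (Fin n) A := fun i j => if i = skip k j then 1 else 0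
      J * C * J.transpose + Matrix.single k.castSucc k.succ 1
  | _, _, .rightCusp _ k, C => fun i j =>
      C (skip k i) (skip k j) +
        τ' * (C (skip k i) k.succ + C (skip k i) k.castSucc * a) *
          (C k.castSucc (skip k j) + a * C k.succ (skip k j))

/-- The degree of the generator of an event, in terms of the Maslov potential on its left. -/
def Event.degree {r : ℕ} : {n n' : ℕ} → Event n n' → (Fin n → ZMod (2 * r)) → ZMod (2 * r)
  | _, _, .crossing _ k, μ => μ k.castSucc - μ k.succ
  | _, _, .rightCusp _ _, _ => 1
  | _, _, _, _ => 0

namespace Front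

/-- The generators of the DGA of the dipped diagram: the crossings `a` of the resolved front, and
the crossings of the dips, one dip at each slice. The generators `c m i j` belong to the dip at
slice `m` and the generators `b m i j` to the dip at slice `m + 1`, for strands `i < j`. -/
inductive Gen (D : Front) : Type
  | a (m : Fin (D.M + 1)) (h : (D.event m).HasGenerator) : Gen D
  | b (m : Fin (D.M + 1)) (i j : Fin (D.N (m + 1))) (h : i < j) : Gen D
  | c (m : Fin (D.M + 1)) (i j : Fin (D.N m)) (h : i < j) : Gen D

/-- The degree of a generator. -/
def degree {D : Front} {r : ℕ} (μ : D.MaslovPotential r) : D.Gen → ZMod (2 * r)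
  | .a m _ => (D.event m).degree (μ.val m)
  | .b m i j _ => μ.val (m + 1) i - μ.val (m + 1) j
  | .c m i j _ => μ.val m i - μ.val m j - 1

/-- The underlying algebra: the tensor algebra over `ℤ[t₁^{±1}, …, t_s^{±1}]` on the generators. -/
abbrev Alg (D : Front) (s : ℕ) : Type := FreeAlgebra (Laurent s) D.Gen

section DGA

variable (D : Front) {r s : ℕ} (μ : D.MaslovPotential r) (P : D.BasePoints s)

open Classical in
/-- The generator of `event m`, or `0` if there is none. -/
noncomputable def aGen (s : ℕ) (m : Fin (D.M + 1)) : D.Alg s :=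
  if h : (D.event m).HasGenerator then FreeAlgebra.ι _ (Gen.a m h) else 0

/-- The strictly upper triangular matrix of the generators `b` in the dip at slice `m + 1`. -/
noncomputable def matB (s : ℕ) (m : Fin (D.M + 1)) :
    Matrix (Fin (D.N (m + 1))) (Fin (D.N (m + 1))) (D.Alg s) :=
  fun i j => if h : i < j then FreeAlgebra.ι _ (Gen.b m i j h) else 0

/-- The strictly upper triangular matrix of the generators `c` in the dip at slice `m`. -/
noncomputable def matC (s : ℕ) (m : Fin (D.M + 1)) :
    Matrix (Fin (D.N m)) (Fin (D.N m)) (D.Alg s) :=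
  fun i j => if h : i < j then FreeAlgebra.ι _ (Gen.c m i j h) else 0

variable {D}

open Classical in
/-- The exponents of the base points on strand `i` at slice `m`, for a path along the strand to the
right: `+1` if the strand is oriented to the right, `-1` if it is oriented to the left. -/
noncomputable def strandExp (m : Fin (D.M + 1)) (i : Fin (D.N m)) : Fin s → ℤ :=
  fun q => if P.pos q = Site.strand m i then sgn (μ.val m i) else 0

/-- The exponents of the base points on the loop of the right cusp `event m`, if it is one, for a
counterclockwise path: `+1` if the upper strand at the cusp is oriented to the right, `-1` if it is
oriented to the left. -/
def loopExp (m : Fin (D.M + 1)) : Fin s → ℤ :=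
  fun q => match P.pos q with
    | .strand _ _ => 0
    | .loop m' i _ _ => if m' = m then sgn (μ.val m' i) else 0

/-- The matrix `C` of slice `m` after the base points: the boundary of a disk runs to the left
along the upper strand `i` and to the right along the lower strand `j`. -/
noncomputable def basedC (m : Fin (D.M + 1)) :
    Matrix (Fin (D.N m)) (Fin (D.N m)) (D.Alg s) :=
  fun i j => mono (strandExp μ P m j - strandExp μ P m i) • D.matC s m i j

/-- The matrix `C̃` that arrives at the dip at slice `m + 1`. -/
noncomputable def tildeC (m : Fin (D.M + 1)) :
    Matrix (Fin (D.N (m + 1))) (Fin (D.N (m + 1))) (D.Alg s) :=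
  (D.event m).outgoing (D.aGen s m) (sgn ((D.event m).degree (μ.val m)))
    (algebraMap _ _ (mono (-loopExp μ P m))) (basedC μ P m)

/-- The diagonal matrix with entries `(-1)^{μ(i)}` at slice `m`. -/
noncomputable def matSigma (s : ℕ) (m : Fin (D.M + 1)) :
    Matrix (Fin (D.N m)) (Fin (D.N m)) (D.Alg s) :=
  Matrix.diagonal fun i => ((sgn (μ.val m i) : ℤ) : D.Alg s)

/-- The differential on the generators:
`∂C = (Σ C)²` and `∂B = -Σ (1 + B) Σ C + C̃ (1 + B)` in each dip. -/
noncomputable def diffGen : D.Gen → D.Alg s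
  | .a m _ => (D.event m).boundary (algebraMap _ _ (mono (loopExp μ P m))) (basedC μ P m)
  | .b m i j _ =>
      (-(matSigma μ s (m + 1) * (1 + D.matB s m) * matSigma μ s (m + 1) * D.matC s (m + 1)) +
        tildeC μ P m * (1 + D.matB s m)) i j
  | .c m i j _ => ((matSigma μ s m * D.matC s m) ^ 2) i j

/-- The differential of the DGA. -/
noncomputable def diff : D.Alg s → D.Alg s :=
  extend (fun g => sgn (degree μ g)) (diffGen μ P)

/-- An augmentation to `F` is a unital ring map that vanishes on the image of the differential. -/
def IsAugmentation {F : Type*} [Field F] (ε : D.Alg s →+* F) : Prop :=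
  ∀ x : D.Alg s, ε (diff μ P x) = 0

end DGA

end Front

end SolidTorus

/-!
Send the generator `c i j` of a dip to `1` if the ruling pairs the strands `i < j`, and to `0`
otherwise. Once a suitable unit is placed on every strand, the matrices `C` at the two sides of an
event are related by a unipotent matrix `1 + B`, as the equation for `∂ B` demands. At a switch this
rests on normality: it provides a unipotent matrix that, multiplied by the lower triangular
transvection of the crossing strands, commutes with the matrix of the involution.

Conjugating the matrices `C` by diagonal matrices is a gauge transformation. It slides units along
the components of the link, inverting them where the strand changes its direction, so that all of
them can be collected at the base points without changing their oriented product. The unit on a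
self-paired strand enters none of the equations, so this product can be prescribed.
-/

namespace SolidTorus

open Matrix

/-! ### Neighbouring strands -/

section Strands

variable {n : ℕ} (k : Fin (n + 1))

theorem skip_strictMono : StrictMono (skip k) :=
  (Fin.strictMono_succAbove _).comp (Fin.strictMono_succAbove _)

theorem skip_injective : Function.Injective (skip k) := (skip_strictMono k).injective

theorem skip_ne_succ (i : Fin n) : skip k i ≠ k.succ := Fin.succAbove_ne _ _

theorem skip_ne_castSucc (i : Fin n) : skip k i ≠ k.castSucc := by
  intro h
  rw [← Fin.succAbove_succ_self k] at h
  exact Fin.succAbove_ne _ _ (Fin.succAbove_right_injective h)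

theorem eq_castSucc_or_eq_succ_or_exists_eq_skip (i : Fin (n + 2)) :
    i = k.castSucc ∨ i = k.succ ∨ ∃ j, i = skip k j := by
  rcases eq_or_ne i k.succ with h | h
  · exact Or.inr (Or.inl h)
  obtain ⟨j, rfl⟩ := Fin.exists_succAbove_eq h
  rcases eq_or_ne j k with rfl | hj
  · exact Or.inl (Fin.succAbove_succ_self j)
  obtain ⟨l, rfl⟩ := Fin.exists_succAbove_eq hj
  exact Or.inr (Or.inr ⟨l, rfl⟩)

theorem transp_transp (i : Fin (n + 2)) : transp k (transp k i) = i :=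
  Equiv.swap_apply_self _ _ _

theorem transp_lt_transp_iff {i j : Fin (n + 2)} (h : ¬(i = k.castSucc ∧ j = k.succ))
    (h' : ¬(i = k.succ ∧ j = k.castSucc)) : transp k i < transp k j ↔ i < j := by
  have val_transp (i : Fin (n + 2)) :
      (transp k i : ℕ) =
        if (i : ℕ) = k then (k : ℕ) + 1 else if (i : ℕ) = (k : ℕ) + 1 then (k : ℕ) else i := by
    simp only [transp, Equiv.swap_apply_def, Fin.ext_iff, Fin.val_castSucc, Fin.val_succ]
    split_ifs <;> rfl
  simp only [Fin.ext_iff, Fin.val_castSucc, Fin.val_succ] at h h'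
  simp only [Fin.lt_def, val_transp]
  split_ifs <;> omega

end Strands

/-! ### Matrices over a commutative ring -/

section StrictUpper

variable {ι K : Type*} [Preorder ι] [CommRing K]

/-- A matrix is strictly upper triangular if its entries vanish on and below the diagonal. -/
def StrictUpper (A : Matrix ι ι K) : Prop :=
  ∀ ⦃i j⦄, ¬i < j → A i j = 0

theorem StrictUpper.zero : StrictUpper (0 : Matrix ι ι K) := fun _ _ _ => rfl

theorem StrictUpper.add {A B : Matrix ι ι K} (hA : StrictUpper A) (hB : StrictUpper B) :
    StrictUpper (A + B) := fun i j h => by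
  rw [Matrix.add_apply, hA h, hB h, add_zero]

theorem StrictUpper.mul [Fintype ι] {A B : Matrix ι ι K} (hA : StrictUpper A)
    (hB : StrictUpper B) : StrictUpper (A * B) := fun i j h => by
  rw [Matrix.mul_apply]
  refine Finset.sum_eq_zero fun l _ => ?_
  by_cases hil : i < l
  · rw [hB fun hlj => h (hil.trans hlj), mul_zero]
  · rw [hA hil, zero_mul]

theorem StrictUpper.single [DecidableEq ι] {i j : ι} (h : i < j) (c : K) :
    StrictUpper (Matrix.single i j c) := fun a b hab => by
  rw [Matrix.single_apply, if_neg]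
  rintro ⟨rfl, rfl⟩
  exact hab h

end StrictUpper

section DiagConj

variable {ι κ K : Type*} [Fintype ι] [DecidableEq ι] [Fintype κ] [DecidableEq κ] [CommRing K]

/-- The conjugation `A ↦ T⁻¹ A T` by the diagonal matrix `T` with entries `t`. -/
def diagConj (t : ι → Kˣ) : Matrix ι ι K →+* Matrix ι ι K where
  toFun A := of fun i j => ↑(t i)⁻¹ * A i j * t j
  map_zero' := by ext; simp
  map_add' A B := by ext; simp [mul_add, add_mul]
  map_one' := by
    ext i j
    rcases eq_or_ne i j with rfl | h
    · simp
    · simp [h]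
  map_mul' A B := by
    ext i j
    simp only [of_apply, mul_apply, Finset.mul_sum, Finset.sum_mul]
    refine Finset.sum_congr rfl fun l _ => ?_
    linear_combination (-↑(t i)⁻¹ * A i l * B l j * t j : K) * (t l).mul_inv

theorem diagConj_apply (t : ι → Kˣ) (A : Matrix ι ι K) (i j : ι) :
    diagConj t A i j = ↑(t i)⁻¹ * A i j * t j := rfl

theorem diagConj_diagConj (t u : ι → Kˣ) (A : Matrix ι ι K) :
    diagConj t (diagConj u A) = diagConj (t * u) A := by
  ext i j
  simp only [diagConj_apply, Pi.mul_apply, mul_inv, Units.val_mul]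
  ring

theorem diagConj_diagonal (t : ι → Kˣ) (d : ι → K) : diagConj t (diagonal d) = diagonal d := by
  ext i j
  rcases eq_or_ne i j with rfl | h
  · simp [diagConj_apply, mul_right_comm]
  · simp [diagConj_apply, h]

theorem diagConj_single (t : ι → Kˣ) (i j : ι) (c : K) :
    diagConj t (Matrix.single i j c) = Matrix.single i j (↑(t i)⁻¹ * c * t j) := by
  ext a b
  rw [diagConj_apply, single_apply, single_apply]
  split_ifs with h
  · rw [h.1, h.2]
  · simp

theorem diagConj_transvection (t : ι → Kˣ) (i j : ι) (c : K) :
    diagConj t (transvection i j c) = transvection i j (↑(t i)⁻¹ * c * t j) := by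
  rw [transvection, map_add, map_one, diagConj_single, transvection]

theorem diagConj_submatrix (t : ι → Kˣ) (f : κ → ι) (A : Matrix ι ι K) :
    diagConj (t ∘ f) (A.submatrix f f) = (diagConj t A).submatrix f f := rfl

theorem diagConj_eq_diagonal_mul_mul_diagonal (t : ι → Kˣ) (A : Matrix ι ι K) :
    diagConj t A = diagonal (fun i => (↑(t i)⁻¹ : K)) * A * diagonal (fun i => (t i : K)) := by
  ext i j
  rw [mul_diagonal, diagonal_mul, diagConj_apply]

theorem StrictUpper.diagConj [Preorder ι] {A : Matrix ι ι K} (hA : StrictUpper A)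
    (t : ι → Kˣ) : StrictUpper (diagConj t A) := fun i j h => by
  rw [diagConj_apply, hA h, mul_zero, zero_mul]

end DiagConj

section NegAt

variable {ι K : Type*} [DecidableEq ι] [CommRing K]

/-- The diagonal matrix with the entry `-1` at `j` and `1` elsewhere, as a family of units. -/
def negAt (K : Type*) [CommRing K] (j : ι) : ι → Kˣ := Function.update 1 j (-1)

theorem diagonal_negAt (j : ι) :
    diagonal (fun i => (negAt K j i : K)) = 1 - Matrix.single j j 2 := by
  rw [← diagonal_single, ← diagonal_one, diagonal_sub]
  congr 1
  ext i
  rcases eq_or_ne i j with rfl | h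
  · rw [negAt, Function.update_self, Units.val_neg, Units.val_one, Pi.single_eq_same]
    norm_num
  · simp [negAt, h]

theorem inv_negAt_apply (i j : ι) : (negAt K j i)⁻¹ = negAt K j i := by
  rcases eq_or_ne i j with rfl | h
  · simp [negAt]
  · simp [negAt, h]

end NegAt

section Swap

variable {ι K : Type*} [DecidableEq ι] [CommRing K]

theorem swap_eq {i j : ι} (hij : i ≠ j) :
    swap K i j = 1 - Matrix.single i i 1 - Matrix.single j j 1 + Matrix.single i j 1
      + Matrix.single j i 1 := by
  ext a b
  simp only [swap, PEquiv.toMatrix_apply, Equiv.toPEquiv_apply, Option.mem_some_iff,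
    Equiv.swap_apply_def, Matrix.add_apply, Matrix.sub_apply, one_apply, single_apply]
  grind

variable [Fintype ι]

theorem swap_mul_mul_swap (i j : ι) (A : Matrix ι ι K) :
    swap K i j * A * swap K i j = A.submatrix (Equiv.swap i j) (Equiv.swap i j) := by
  ext a b
  simp [swap, PEquiv.toMatrix_toPEquiv_mul, PEquiv.mul_toMatrix_toPEquiv]

theorem transvection_mul_swap_mul_transvection {i j : ι} (hij : i ≠ j) :
    transvection i j (1 : K) * swap K i j * transvection i j (-1) =
      diagonal (fun l => (negAt K j l : K)) * transvection j i (-1) := by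
  have two : Matrix.single j j (2 : K) = Matrix.single j j 1 + Matrix.single j j 1 := by
    rw [← single_add, one_add_one_eq_two]
  simp only [swap_eq hij, diagonal_negAt, two, transvection, ← single_neg, mul_add, add_mul,
    mul_sub, sub_mul, mul_one, one_mul, mul_neg, single_mul_single_same,
    single_mul_single_of_ne _ _ _ _ hij.symm]
  abel

theorem submatrix_swap_mul_eq_of_commute {i j : ι} (hij : i ≠ j) {W Y : Matrix ι ι K}
    (hW : Commute W (transvection j i (-1) * Y)) :
    (transvection i j (-1) * diagConj (negAt K j) W * transvection i j 1).submatrix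
        (Equiv.swap i j) (Equiv.swap i j) * (transvection i j (-1) * Y) =
      transvection i j (-1) * Y * W := by
  have hd : diagConj (negAt K j) W =
      diagonal (fun l => (negAt K j l : K)) * W * diagonal (fun l => (negAt K j l : K)) := by
    simp only [diagConj_eq_diagonal_mul_mul_diagonal, inv_negAt_apply]
  have hEPE := transvection_mul_swap_mul_transvection (K := K) hij
  rw [← swap_mul_mul_swap, hd]
  set E := transvection i j (1 : K)
  set E' := transvection i j (-1 : K)
  set P := swap K i j
  set d := diagonal (fun l => (negAt K j l : K)) with hd_def
  set Z := transvection j i (-1 : K)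
  have hE'E : E' * E = 1 := by
    rw [transvection_mul_transvection_same _ _ hij, neg_add_cancel, transvection_zero]
  have hdd : d * d = 1 := by
    rw [hd_def, diagonal_mul_diagonal, ← diagonal_one]
    congr 1
    ext l
    rw [← Units.val_mul, mul_eq_one_iff_inv_eq.mpr (inv_negAt_apply l j), Units.val_one]
  have hPP : P * P = 1 := swap_mul_self _ _
  calc P * (E' * (d * W * d) * E) * P * (E' * Y)
      = P * E' * d * W * d * (E * P * E') * Y := by noncomm_ring
    _ = P * E' * d * W * (d * d) * Z * Y := by rw [hEPE]; noncomm_ring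
    _ = P * E' * d * (W * (Z * Y)) := by rw [hdd]; noncomm_ring
    _ = P * E' * (d * Z) * Y * W := by rw [hW.eq]; noncomm_ring
    _ = P * (E' * E) * P * E' * Y * W := by rw [← hEPE]; noncomm_ring
    _ = E' * Y * W := by rw [hE'E, mul_one, hPP, one_mul]

end Swap

/-! ### The matrix of an involution -/

section RulingMatrix

variable {ι K : Type*} [LinearOrder ι] [CommRing K]

/-- The strictly upper triangular matrix with the entry `s i` at `(i, σ i)` whenever `i < σ i`. For
`s = 1` these are the values of an augmentation on the generators `c` of a dip. -/
def rulingMatrix (σ : ι → ι) (s : ι → Kˣ) : Matrix ι ι K :=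
  of fun i j => if i < j ∧ σ i = j then (s i : K) else 0

theorem rulingMatrix_apply (σ : ι → ι) (s : ι → Kˣ) (i j : ι) :
    rulingMatrix σ s i j = if i < j ∧ σ i = j then (s i : K) else 0 := rfl

theorem strictUpper_rulingMatrix (σ : ι → ι) (s : ι → Kˣ) : StrictUpper (rulingMatrix σ s) :=
  fun _ _ h => if_neg fun h' => h h'.1

theorem rulingMatrix_congr {σ : ι → ι} {s t : ι → Kˣ} (h : ∀ i, i < σ i → s i = t i) :
    rulingMatrix σ s = rulingMatrix σ t := by
  ext i j
  rw [rulingMatrix_apply, rulingMatrix_apply]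
  split_ifs with hij
  · rw [h i (hij.2 ▸ hij.1)]
  · rfl

variable [Fintype ι]

theorem rulingMatrix_mul_self {σ : ι → ι} (hσ : Function.Involutive σ) (s : ι → Kˣ) :
    rulingMatrix σ s * rulingMatrix σ s = 0 := by
  ext i j
  rw [Matrix.mul_apply, Matrix.zero_apply]
  refine Finset.sum_eq_zero fun l _ => ?_
  rw [rulingMatrix_apply, rulingMatrix_apply]
  split_ifs with hil hlj
  · obtain ⟨hil, rfl⟩ := hil
    rw [hσ] at hlj
    exact absurd (hil.trans (hlj.2 ▸ hlj.1)) (lt_irrefl i)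
  all_goals simp

theorem diagonal_mul_rulingMatrix (w : ι → Kˣ) (σ : ι → ι) (s : ι → Kˣ) :
    diagonal (fun i => (w i : K)) * rulingMatrix σ s = rulingMatrix σ (w * s) := by
  ext i j
  rw [diagonal_mul, rulingMatrix_apply, rulingMatrix_apply, mul_ite, mul_zero]
  rfl

theorem diagConj_rulingMatrix (t : ι → Kˣ) (σ : ι → ι) (s : ι → Kˣ) :
    diagConj t (rulingMatrix σ s) = rulingMatrix σ fun i => (t i)⁻¹ * s i * t (σ i) := by
  ext i j
  rw [diagConj_apply, rulingMatrix_apply, rulingMatrix_apply]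
  split_ifs with h
  · rw [h.2, Units.val_mul, Units.val_mul]
  · rw [mul_zero, zero_mul]

theorem diagConj_rulingMatrix_congr {σ : ι → ι} (hσ : Function.Involutive σ) (s : ι → Kˣ)
    {t u : ι → Kˣ} (h : ∀ i, σ i ≠ i → t i = u i) :
    diagConj t (rulingMatrix σ s) = diagConj u (rulingMatrix σ s) := by
  rw [diagConj_rulingMatrix, diagConj_rulingMatrix]
  refine rulingMatrix_congr fun i hi => ?_
  rw [h i hi.ne', h (σ i) (by rw [hσ]; exact hi.ne)]

theorem exists_diagConj_rulingMatrix_eq {σ : ι → ι} (hσ : Function.Involutive σ) (s u : ι → Kˣ) :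
    ∃ t : ι → Kˣ, diagConj t (rulingMatrix σ s) = rulingMatrix σ u := by
  refine ⟨fun i => if i < σ i then s i * (u i)⁻¹ else 1, ?_⟩
  rw [diagConj_rulingMatrix]
  refine rulingMatrix_congr fun i hi => ?_
  rw [hσ, if_pos hi, if_neg hi.not_gt, mul_one, mul_inv, inv_inv, mul_right_comm, inv_mul_cancel,
    one_mul]

theorem rulingMatrix_mul_single {σ : ι → ι} (hσ : Function.Involutive σ) (s : ι → Kˣ) (i j : ι)
    (c : K) :
    rulingMatrix σ s * single i j c = if σ i < i then single (σ i) j (s (σ i) * c) else 0 := by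
  ext a b
  rcases eq_or_ne b j with rfl | hb
  · rw [mul_single_apply_same, rulingMatrix_apply]
    rcases eq_or_ne (σ i) a with rfl | ha
    · by_cases h : σ i < i <;> simp [h, hσ i]
    · have : σ a ≠ i := fun h => ha (by rw [← h, hσ])
      split_ifs <;> simp_all
  · rw [mul_single_apply_of_ne _ _ _ _ _ hb]
    split_ifs <;> simp [hb.symm]

theorem single_mul_rulingMatrix (σ : ι → ι) (s : ι → Kˣ) (i j : ι) (c : K) :
    single i j c * rulingMatrix σ s = if j < σ j then single i (σ j) (c * s j) else 0 := by
  ext a b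
  rcases eq_or_ne a i with rfl | ha
  · rw [single_mul_apply_same, rulingMatrix_apply]
    rcases eq_or_ne (σ j) b with rfl | hb
    · by_cases h : j < σ j <;> simp [h]
    · split_ifs <;> simp_all
  · rw [single_mul_apply_of_ne _ _ _ _ _ ha]
    split_ifs <;> simp [ha.symm]

end RulingMatrix

/-! ### Switches -/

section Switch

variable {n : ℕ} {K : Type*} [CommRing K] {k : Fin (n + 1)} {σ : Fin (n + 2) → Fin (n + 2)}

/-- If both crossing strands are paired to the same side, the companions have to be mixed as well;
otherwise the lower triangular transvection commutes by itself. -/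
theorem Normality.exists_commute_rulingMatrix (h : Normality k σ) (hσ : Function.Involutive σ)
    (s : Fin (n + 2) → Kˣ) :
    ∃ N : Matrix (Fin (n + 2)) (Fin (n + 2)) K, StrictUpper N ∧
      Commute (rulingMatrix σ s) (transvection k.succ k.castSucc (-1) * (1 + N)) := by
  have hk : k.castSucc < k.succ := Fin.castSucc_lt_succ
  have cases : (¬σ k.succ < k.succ ∧ ¬k.castSucc < σ k.castSucc) ∨
      (σ k.succ < σ k.castSucc ∧ σ k.castSucc < k.castSucc) ∨
      (k.succ < σ k.succ ∧ σ k.succ < σ k.castSucc) := by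
    rcases h with h | h | h | h | h
    · exact Or.inr (Or.inl h)
    · exact Or.inl ⟨h.2.not_gt, h.1.not_gt⟩
    · exact Or.inr (Or.inr h)
    · exact Or.inl ⟨h.2.not_gt, h.1.not_gt⟩
    · exact Or.inl ⟨h.2.not_lt, h.1.not_gt⟩
  rcases cases with ⟨hq, hp⟩ | ⟨hqp, hp⟩ | ⟨hq, hqp⟩
  · refine ⟨0, .zero, ?_⟩
    rw [Commute, SemiconjBy, add_zero, mul_one, transvection, mul_add, add_mul,
      rulingMatrix_mul_single hσ, single_mul_rulingMatrix, if_neg hq, if_neg hp, mul_one, one_mul]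
  · refine ⟨single (σ k.succ) (σ k.castSucc) (-(s (σ k.succ) * ↑(s (σ k.castSucc))⁻¹)),
      .single hqp _, ?_⟩
    have hne : k.castSucc ≠ σ k.succ := (hqp.trans hp).ne'
    have hq : σ k.succ < k.succ := hqp.trans (hp.trans hk)
    simp only [Commute, SemiconjBy, transvection, mul_add, add_mul, mul_one, one_mul,
      rulingMatrix_mul_single hσ, single_mul_rulingMatrix, single_mul_single_of_ne _ _ _ _ hne,
      hσ k.succ, hσ k.castSucc, if_pos hq, if_neg hp.not_gt, if_neg hq.not_gt, if_pos hp]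
    simp
  · refine ⟨single (σ k.succ) (σ k.castSucc) (-(s k.castSucc * ↑(s k.succ)⁻¹)),
      .single hqp _, ?_⟩
    have hne : k.castSucc ≠ σ k.succ := (hk.trans hq).ne
    have hp : k.castSucc < σ k.castSucc := hk.trans (hq.trans hqp)
    simp only [Commute, SemiconjBy, transvection, mul_add, add_mul, mul_one, one_mul,
      rulingMatrix_mul_single hσ, single_mul_rulingMatrix, single_mul_single_of_ne _ _ _ _ hne,
      hσ k.succ, hσ k.castSucc, if_pos hq, if_neg hq.not_gt, if_neg hp.not_gt, if_pos hp]
    simp [mul_left_comm]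

theorem Normality.exists_conj_rulingMatrix (h : Normality k σ) (hσ : Function.Involutive σ)
    (s : Fin (n + 2) → Kˣ) :
    ∃ B : Matrix (Fin (n + 2)) (Fin (n + 2)) K, StrictUpper B ∧
      (transvection k.castSucc k.succ (-1) * diagConj (negAt K k.succ) (rulingMatrix σ s) *
          transvection k.castSucc k.succ 1).submatrix (transp k) (transp k) * (1 + B) =
        (1 + B) * rulingMatrix σ s := by
  obtain ⟨N, hN, hcomm⟩ := h.exists_commute_rulingMatrix hσ s
  have hk : k.castSucc < k.succ := Fin.castSucc_lt_succ
  have hS : StrictUpper (single k.castSucc k.succ (-1 : K)) := .single hk _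
  refine ⟨single k.castSucc k.succ (-1) + N + single k.castSucc k.succ (-1) * N,
    (hS.add hN).add (hS.mul hN), ?_⟩
  have hB : (1 : Matrix _ _ K) + (single k.castSucc k.succ (-1) + N +
      single k.castSucc k.succ (-1) * N) = transvection k.castSucc k.succ (-1) * (1 + N) := by
    rw [transvection, add_mul, one_mul, mul_add, mul_one]
    abel
  rw [hB]
  exact submatrix_swap_mul_eq_of_commute hk.ne hcomm

end Switch

/-! ### Signs -/

section Signs

variable {r : ℕ}

theorem sgn_mul_self (d : ZMod (2 * r)) : sgn d * sgn d = 1 := by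
  unfold sgn
  split_ifs <;> norm_num

theorem sgn_sub (d e : ZMod (2 * r)) : sgn (d - e) = sgn d * sgn e := by
  unfold sgn
  rw [map_sub]
  generalize ZMod.castHom (Dvd.intro r rfl) (ZMod 2) d = x
  generalize ZMod.castHom (Dvd.intro r rfl) (ZMod 2) e = y
  revert x y
  decide

theorem sgn_add_one (d : ZMod (2 * r)) : sgn (d + 1) = -sgn d := by
  unfold sgn
  rw [map_add, map_one]
  generalize ZMod.castHom (Dvd.intro r rfl) (ZMod 2) d = x
  revert x
  decide

variable (K : Type*) [CommRing K]

/-- The sign `(-1)^d` as a unit of `K`. -/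
def sgnUnit (d : ZMod (2 * r)) : Kˣ where
  val := (sgn d : K)
  inv := (sgn d : K)
  val_inv := by exact_mod_cast congrArg (Int.cast : ℤ → K) (sgn_mul_self d)
  inv_val := by exact_mod_cast congrArg (Int.cast : ℤ → K) (sgn_mul_self d)

theorem sgnUnit_mul_self (d : ZMod (2 * r)) : sgnUnit K d * sgnUnit K d = 1 :=
  inv_mul_cancel (sgnUnit K d)

variable {ι : Type*} [DecidableEq ι]

/-- The diagonal matrix `Σ` with the entries `(-1)^{d i}`. -/
def signMatrix (d : ι → ZMod (2 * r)) : Matrix ι ι K := diagonal fun i => (sgnUnit K (d i) : K)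

theorem signMatrix_mul_self [Fintype ι] (d : ι → ZMod (2 * r)) :
    signMatrix K d * signMatrix K d = 1 := by
  simp only [signMatrix, diagonal_mul_diagonal, ← Units.val_mul, sgnUnit_mul_self, Units.val_one,
    diagonal_one]

theorem signMatrix_mul_transvection [Fintype ι] (d : ι → ZMod (2 * r)) (i j : ι) (c : K) :
    signMatrix K d * transvection i j (sgn (d i - d j) * c) =
      transvection i j c * signMatrix K d := by
  have hi : ((sgn (d i) : ℤ) : K) * (sgn (d i) : ℤ) = 1 := (sgnUnit K (d i)).mul_inv
  rw [transvection, transvection, mul_add, add_mul, mul_one, one_mul, add_right_inj, signMatrix]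
  ext a b
  rw [diagonal_mul, mul_diagonal, single_apply, single_apply]
  split_ifs with h
  · obtain ⟨rfl, rfl⟩ := h
    rw [sgn_sub, Int.cast_mul]
    change (sgn (d i) : K) * _ = _ * (sgn (d j) : K)
    linear_combination (sgn (d j) * c : K) * hi
  · rw [mul_zero, zero_mul]

theorem signMatrix_mul_rulingMatrix {ι : Type*} [LinearOrder ι] [Fintype ι]
    (d : ι → ZMod (2 * r)) (σ : ι → ι) (s : ι → Kˣ) :
    signMatrix K d * rulingMatrix σ s = rulingMatrix σ fun i => sgnUnit K (d i) * s i :=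
  diagonal_mul_rulingMatrix (fun i => sgnUnit K (d i)) σ s

end Signs

/-! ### Events -/

namespace Event

section Outgoing

variable {A A' : Type} [Ring A] [Ring A'] {n n' : ℕ}

theorem map_boundary (f : A →+* A') (e : Event n n') (τ : A) (C : Matrix (Fin n) (Fin n) A) :
    f (e.boundary τ C) = e.boundary (f τ) (C.map f) := by
  cases e <;> simp [boundary]

theorem outgoing_leftCusp (k : Fin (n + 1)) (a : A) (sa : ℤ) (τ' : A)
    (C : Matrix (Fin n) (Fin n) A) :
    (leftCusp n k).outgoing a sa τ' C =
      (1 : Matrix _ _ A).submatrix id (skip k) * C * ((1 : Matrix _ _ A).submatrix id (skip k))ᵀ +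
        single k.castSucc k.succ 1 := by
  have insertion : (1 : Matrix _ _ A).submatrix id (skip k) =
      of fun i j => if i = skip k j then 1 else 0 := by
    ext i j
    simp [one_apply]
  rw [insertion]
  rfl

theorem outgoing_leftCusp_skip (k : Fin (n + 1)) (a : A) (sa : ℤ) (τ' : A)
    (C : Matrix (Fin n) (Fin n) A) (i j : Fin n) :
    (leftCusp n k).outgoing a sa τ' C (skip k i) (skip k j) = C i j := by
  rw [outgoing_leftCusp, Matrix.add_apply, Matrix.mul_apply]
  simp [Matrix.mul_apply, one_apply, (skip_injective k).eq_iff, (skip_ne_castSucc k i).symm]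

theorem outgoing_leftCusp_of_notMem (k : Fin (n + 1)) (a : A) (sa : ℤ) (τ' : A)
    (C : Matrix (Fin n) (Fin n) A) {i j : Fin (n + 2)}
    (h : i ∉ Set.range (skip k) ∨ j ∉ Set.range (skip k)) :
    (leftCusp n k).outgoing a sa τ' C i j = single k.castSucc k.succ 1 i j := by
  rw [outgoing_leftCusp, Matrix.add_apply, add_eq_right, Matrix.mul_apply]
  refine Finset.sum_eq_zero fun b _ => ?_
  rcases h with h | h
  · rw [Matrix.mul_apply, Finset.sum_eq_zero fun c _ => ?_, zero_mul]
    rw [submatrix_apply, id, one_apply_ne fun hc => h ⟨c, hc.symm⟩, zero_mul]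
  · rw [transpose_apply, submatrix_apply, id, one_apply_ne fun hb => h ⟨b, hb.symm⟩, mul_zero]

theorem map_outgoing (f : A →+* A') (e : Event n n') (a : A) (sa : ℤ) (τ' : A)
    (C : Matrix (Fin n) (Fin n) A) :
    (e.outgoing a sa τ' C).map f = e.outgoing (f a) sa (f τ') (C.map f) := by
  cases e with
  | trivial => rfl
  | crossing n k =>
    refine Matrix.map_mul.trans (congrArg₂ _ (Matrix.map_mul.trans (congrArg₂ _ ?_ ?_)) ?_)
    all_goals
      ext i j
      change f _ = _
      simp [apply_ite f, updateRow_apply, Function.update_apply]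
  | leftCusp n k =>
    rw [outgoing_leftCusp, outgoing_leftCusp, Matrix.map_add f (map_add f), Matrix.map_mul,
      Matrix.map_mul, transpose_map, ← submatrix_map, Matrix.map_one f f.map_zero f.map_one,
      map_single, map_one]
  | rightCusp n k =>
    ext i j
    change f _ = _
    simp [outgoing]

theorem outgoing_congr {e : Event n n'} {a a' : A} (h : e.HasGenerator → a = a') (sa : ℤ) (τ' : A)
    (C : Matrix (Fin n) (Fin n) A) : e.outgoing a sa τ' C = e.outgoing a' sa τ' C := by
  cases e with
  | trivial => rfl
  | crossing n k => rw [h _root_.trivial]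
  | leftCusp n k => rfl
  | rightCusp n k => rw [h _root_.trivial]

theorem outgoing_crossing {K : Type} [CommRing K] (k : Fin (n + 1)) (a : K) (sa : ℤ) (τ' : K)
    (C : Matrix (Fin (n + 2)) (Fin (n + 2)) K) :
    (crossing n k).outgoing a sa τ' C =
      (transvection k.castSucc k.succ (-(sa • a)) *
          (C - single k.castSucc k.succ (C k.castSucc k.succ)) *
          transvection k.castSucc k.succ a).submatrix (transp k) (transp k) := by
  have hk : k.castSucc ≠ k.succ := Fin.castSucc_lt_succ.ne
  rw [transp, ← swap_mul_mul_swap]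
  simp only [outgoing, ← Matrix.mul_assoc]
  rw [Matrix.mul_assoc _ (transvection k.castSucc k.succ a)]
  congr 1
  · congr 1
    · ext i j
      rcases eq_or_ne i k.castSucc with rfl | hp
      · simp [transvection, one_apply, hk, eq_comm]
      rcases eq_or_ne i k.succ with rfl | hq
      · simp [transvection, one_apply, single_apply, hk.symm, eq_comm]
        grind
      · simp [swap_mul_of_ne hp hq, transvection, one_apply, hp, hq, hp.symm]
    · ext i j
      simp only [updateRow_apply, Function.update_apply, Matrix.sub_apply, single_apply]
      grind
  · ext i j
    rcases eq_or_ne j k.castSucc with rfl | hp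
    · simp [transvection, one_apply, single_apply]
      grind
    rcases eq_or_ne j k.succ with rfl | hq
    · simp [transvection, one_apply, single_apply]
      grind
    · simp [mul_swap_of_ne hp hq, transvection, one_apply, hp, hq, hq.symm]
      grind

end Outgoing

section Gauge

variable {K : Type} [CommRing K] {n n' : ℕ} {e : Event n n'} {g : Fin n' → Kˣ} {h : Fin n → Kˣ}
  {κ : Kˣ}

theorem boundary_diagConj_eq_zero (right : ∀ i j, e.RightCuspAt i j → h j = κ * h i)
    {τ : K} {C : Matrix (Fin n) (Fin n) K} (hC : e.boundary τ C = 0) :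
    e.boundary (τ * κ) (diagConj h C) = 0 := by
  cases e with
  | trivial => rfl
  | leftCusp => rfl
  | crossing n k =>
    change diagConj h C k.castSucc k.succ = 0
    rw [diagConj_apply, show C k.castSucc k.succ = 0 from hC, mul_zero, zero_mul]
  | rightCusp n k =>
    change τ * κ + diagConj h C k.castSucc k.succ = 0
    rw [diagConj_apply, right _ _ ⟨rfl, rfl⟩, Units.val_mul, mul_comm (κ : K), ← mul_assoc,
      mul_right_comm _ _ (h k.castSucc : K), Units.inv_mul, one_mul, ← add_mul,
      show τ + C k.castSucc k.succ = 0 from hC, zero_mul]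

theorem outgoing_crossing_diagConj (k : Fin (n + 1)) {g h : Fin (n + 2) → Kˣ}
    (through : ∀ i, h i = g (transp k i)) (a : K) (sa : ℤ) (τ' τ'' : K)
    (C : Matrix (Fin (n + 2)) (Fin (n + 2)) K) :
    (crossing n k).outgoing (↑(h k.castSucc)⁻¹ * a * h k.succ) sa τ'' (diagConj h C) =
      diagConj g ((crossing n k).outgoing a sa τ' C) := by
  have hg : g = h ∘ transp k := by
    ext i
    rw [Function.comp_apply, through, transp_transp]
  rw [outgoing_crossing, outgoing_crossing, hg, diagConj_submatrix, map_mul, map_mul, map_sub,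
    diagConj_transvection, diagConj_transvection, diagConj_single, diagConj_apply, mul_neg, neg_mul,
    mul_smul_comm, smul_mul_assoc]

theorem outgoing_leftCusp_diagConj (k : Fin (n + 1)) {g : Fin (n + 2) → Kˣ} {h : Fin n → Kˣ}
    (through : ∀ i, h i = g (skip k i)) (left : g k.castSucc = g k.succ) (a a' : K) (sa : ℤ)
    (τ' τ'' : K) (C : Matrix (Fin n) (Fin n) K) :
    (leftCusp n k).outgoing a' sa τ'' (diagConj h C) =
      diagConj g ((leftCusp n k).outgoing a sa τ' C) := by
  ext i j
  rw [diagConj_apply]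
  by_cases hij : i ∉ Set.range (skip k) ∨ j ∉ Set.range (skip k)
  · rw [outgoing_leftCusp_of_notMem _ _ _ _ _ hij, outgoing_leftCusp_of_notMem _ _ _ _ _ hij,
      single_apply]
    split_ifs with h
    · rw [← h.1, ← h.2, left, mul_one, Units.inv_mul]
    · rw [mul_zero, zero_mul]
  · obtain ⟨⟨i, rfl⟩, j, rfl⟩ : i ∈ Set.range (skip k) ∧ j ∈ Set.range (skip k) := by
      simpa only [not_or, not_not] using hij
    rw [outgoing_leftCusp_skip, outgoing_leftCusp_skip, diagConj_apply, through, through]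

theorem outgoing_rightCusp_diagConj (k : Fin (n + 1)) {g : Fin n → Kˣ} {h : Fin (n + 2) → Kˣ}
    (through : ∀ i, h (skip k i) = g i) {κ : Kˣ} (right : h k.succ = κ * h k.castSucc) (a : K)
    (sa : ℤ) (τ' : K) (C : Matrix (Fin (n + 2)) (Fin (n + 2)) K) :
    (rightCusp n k).outgoing (↑(h k.castSucc)⁻¹ * a * h k.succ) sa (↑κ⁻¹ * τ') (diagConj h C) =
      diagConj g ((rightCusp n k).outgoing a sa τ' C) := by
  ext i j
  have hκ : (↑κ⁻¹ : K) * h k.succ * ↑(h k.castSucc)⁻¹ = 1 := by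
    rw [right, Units.val_mul, Units.inv_mul_cancel_left, Units.mul_inv]
  have hp := (h k.castSucc).mul_inv
  have hq := (h k.succ).mul_inv
  rw [diagConj_apply]
  simp only [outgoing, diagConj_apply, through]
  grind

theorem exists_outgoing_diagConj (through : ∀ i j, e.Through i j → h i = g j)
    (left : ∀ i j, e.LeftCuspAt i j → g i = g j)
    (right : ∀ i j, e.RightCuspAt i j → h j = κ * h i) (a : K) (sa : ℤ) (τ' : K)
    (C : Matrix (Fin n) (Fin n) K) :
    ∃ a', e.outgoing a' sa (↑κ⁻¹ * τ') (diagConj h C) = diagConj g (e.outgoing a sa τ' C) := by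
  cases e with
  | trivial =>
    obtain rfl : h = g := funext fun i => through i i rfl
    exact ⟨a, rfl⟩
  | crossing n k =>
    exact ⟨_, outgoing_crossing_diagConj k (fun i => through i _ rfl) a sa τ' _ C⟩
  | leftCusp n k =>
    exact ⟨a, outgoing_leftCusp_diagConj k (fun i => through i _ rfl) (left _ _ ⟨rfl, rfl⟩) a a sa
      τ' _ C⟩
  | rightCusp n k =>
    exact ⟨_, outgoing_rightCusp_diagConj k (fun i => through _ i rfl) (right _ _ ⟨rfl, rfl⟩) a sa
      τ' C⟩

end Gauge

section RulingStep

variable {K : Type} [CommRing K] {n : ℕ} {k : Fin (n + 1)}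

theorem outgoing_crossing_rulingMatrix {σ : Fin (n + 2) → Fin (n + 2)}
    (hne : σ k.castSucc ≠ k.succ) (hσ : Function.Involutive σ) (sa : ℤ) (τ' : K) :
    (crossing n k).outgoing 0 sa τ' (rulingMatrix σ (1 : Fin (n + 2) → Kˣ)) =
      rulingMatrix (transp k ∘ σ ∘ transp k) 1 := by
  have hne' : σ k.succ ≠ k.castSucc := fun h => hne (by rw [← h, hσ])
  have entry : rulingMatrix σ (1 : Fin (n + 2) → Kˣ) k.castSucc k.succ = 0 :=
    if_neg fun h => hne h.2
  rw [outgoing_crossing, entry, smul_zero, neg_zero, transvection_zero, single_zero, sub_zero,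
    one_mul, mul_one]
  ext i j
  have pairing : (transp k ∘ σ ∘ transp k) i = j ↔ σ (transp k i) = transp k j := by
    rw [Function.comp_apply, Function.comp_apply]
    exact ⟨fun h => by rw [← h, transp_transp], fun h => by rw [h, transp_transp]⟩
  rw [submatrix_apply, rulingMatrix_apply, rulingMatrix_apply]
  refine if_congr (Iff.trans (and_congr_left fun h => transp_lt_transp_iff k ?_ ?_)
    (and_congr_right' pairing.symm)) rfl rfl
  · rintro ⟨rfl, rfl⟩
    exact hne' (by simpa [transp] using h)
  · rintro ⟨rfl, rfl⟩
    exact hne (by simpa [transp] using h)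

theorem outgoing_leftCusp_rulingMatrix {σ : Fin n → Fin n} {σ' : Fin (n + 2) → Fin (n + 2)}
    (hcusp : σ' k.castSucc = k.succ) (hskip : ∀ i, σ' (skip k i) = skip k (σ i))
    (hσ' : Function.Involutive σ') (a : K) (sa : ℤ) (τ' : K) :
    (leftCusp n k).outgoing a sa τ' (rulingMatrix σ (1 : Fin n → Kˣ)) = rulingMatrix σ' 1 := by
  have hcusp' : σ' k.succ = k.castSucc := by rw [← hcusp, hσ']
  have hk : k.castSucc < k.succ := Fin.castSucc_lt_succ
  ext i j
  by_cases hij : i ∉ Set.range (skip k) ∨ j ∉ Set.range (skip k)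
  · rw [outgoing_leftCusp_of_notMem _ _ _ _ _ hij, single_apply, rulingMatrix_apply]
    refine if_congr ?_ rfl rfl
    rcases eq_castSucc_or_eq_succ_or_exists_eq_skip k i with rfl | rfl | ⟨i, rfl⟩
    · rw [hcusp]
      exact ⟨fun h => ⟨h.2 ▸ hk, h.2⟩, fun h => ⟨rfl, h.2⟩⟩
    · rw [hcusp']
      exact ⟨fun h => absurd h.1 hk.ne, fun h => absurd (h.2 ▸ h.1) hk.not_gt⟩
    · rw [hskip]
      have hj : j ∉ Set.range (skip k) := hij.resolve_left fun h => h ⟨i, rfl⟩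
      exact ⟨fun h => absurd h.1.symm (skip_ne_castSucc k i), fun h => absurd ⟨_, h.2⟩ hj⟩
  · obtain ⟨⟨i, rfl⟩, j, rfl⟩ : i ∈ Set.range (skip k) ∧ j ∈ Set.range (skip k) := by
      simpa only [not_or, not_not] using hij
    rw [outgoing_leftCusp_skip, rulingMatrix_apply, rulingMatrix_apply, hskip]
    exact if_congr (and_congr (skip_strictMono k).lt_iff_lt.symm (skip_injective k).eq_iff.symm)
      rfl rfl

theorem outgoing_rightCusp_rulingMatrix {σ : Fin (n + 2) → Fin (n + 2)} {σ' : Fin n → Fin n}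
    (hcusp : σ k.castSucc = k.succ) (hskip : ∀ i, σ (skip k i) = skip k (σ' i))
    (sa : ℤ) (τ' : K) :
    (rightCusp n k).outgoing 0 sa τ' (rulingMatrix σ (negAt K k.castSucc)) =
      rulingMatrix σ' 1 := by
  ext i j
  have row : rulingMatrix σ (negAt K k.castSucc) k.castSucc (skip k j) = 0 :=
    if_neg fun h => skip_ne_succ k j (by rw [← h.2, hcusp])
  simp only [outgoing, row, zero_mul, add_zero, mul_zero]
  rw [rulingMatrix_apply, rulingMatrix_apply, hskip, negAt,
    Function.update_of_ne (skip_ne_castSucc k i)]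
  exact if_congr (and_congr (skip_strictMono k).lt_iff_lt (skip_injective k).eq_iff) rfl rfl

/-- The signs of the weights `u` turn `Σ * rulingMatrix σ u` into the `diagConj`-image of
`Σ' * rulingMatrix σ 1` that `Normality.exists_conj_rulingMatrix` asks for. -/
theorem exists_outgoing_switch {σ : Fin (n + 2) → Fin (n + 2)} (hne : σ k.castSucc ≠ k.succ)
    (hσ : Function.Involutive σ) (hN : Normality k σ) {r : ℕ} {μ μ' : Fin (n + 2) → ZMod (2 * r)}
    (hμ : ∀ i, μ' (transp k i) = μ i) (τ' : K) :
    ∃ (u : Fin (n + 2) → Kˣ) (B : Matrix (Fin (n + 2)) (Fin (n + 2)) K), StrictUpper B ∧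
      (crossing n k).outgoing 1 (sgn (μ k.castSucc - μ k.succ)) τ' (rulingMatrix σ u) * (1 + B) =
        signMatrix K μ' * (1 + B) * signMatrix K μ' * rulingMatrix σ 1 := by
  let s' : Fin (n + 2) → Kˣ := fun i => sgnUnit K (μ' i)
  let u : Fin (n + 2) → Kˣ := fun i =>
    sgnUnit K (μ i) * ((negAt K k.succ i)⁻¹ * s' i * negAt K k.succ (σ i))
  obtain ⟨B, hB, hconj⟩ := hN.exists_conj_rulingMatrix hσ s'
  refine ⟨u, B, hB, ?_⟩
  have entry : rulingMatrix σ u k.castSucc k.succ = 0 := if_neg fun h => hne h.2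
  have sign_mul : signMatrix K μ * rulingMatrix σ u =
      diagConj (negAt K k.succ) (rulingMatrix σ s') := by
    rw [signMatrix_mul_rulingMatrix, diagConj_rulingMatrix]
    simp only [u, ← mul_assoc, sgnUnit_mul_self, one_mul]
  have sign' : signMatrix K μ' = (signMatrix K μ).submatrix (transp k) (transp k) := by
    rw [signMatrix, signMatrix, submatrix_diagonal_equiv]
    congr 1
    ext i
    rw [Function.comp_apply, ← hμ, transp_transp]
  have sign_mul_outgoing : signMatrix K μ' *
      (crossing n k).outgoing 1 (sgn (μ k.castSucc - μ k.succ)) τ' (rulingMatrix σ u) =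
        (transvection k.castSucc k.succ (-1) * diagConj (negAt K k.succ) (rulingMatrix σ s') *
          transvection k.castSucc k.succ 1).submatrix (transp k) (transp k) := by
    rw [outgoing_crossing, entry, single_zero, sub_zero, sign', submatrix_mul_equiv,
      ← Matrix.mul_assoc, ← Matrix.mul_assoc, zsmul_eq_mul, ← mul_neg,
      signMatrix_mul_transvection, Matrix.mul_assoc _ (signMatrix K μ), sign_mul]
  calc (crossing n k).outgoing 1 _ τ' (rulingMatrix σ u) * (1 + B)
      = signMatrix K μ' * (signMatrix K μ' * (crossing n k).outgoing 1 _ τ' (rulingMatrix σ u)) *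
          (1 + B) := by rw [← Matrix.mul_assoc, signMatrix_mul_self, one_mul]
    _ = signMatrix K μ' * ((1 + B) * rulingMatrix σ s') := by
      rw [sign_mul_outgoing, Matrix.mul_assoc, hconj]
    _ = signMatrix K μ' * (1 + B) * signMatrix K μ' * rulingMatrix σ 1 := by
      rw [Matrix.mul_assoc _ (signMatrix K μ'), signMatrix_mul_rulingMatrix, Matrix.mul_assoc]
      simp only [Pi.one_apply, mul_one, s']

theorem RulingStep.exists_outgoing {n n' : ℕ} {e : Event n n'} {σ : Fin n → Fin n}
    {σ' : Fin n' → Fin n'} (h : e.RulingStep σ σ') (hσ : Function.Involutive σ)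
    (hσ' : Function.Involutive σ') {r : ℕ} {μ : Fin n → ZMod (2 * r)} {μ' : Fin n' → ZMod (2 * r)}
    (hμ : ∀ i j, e.Through i j → μ' j = μ i) :
    ∃ (u : Fin n → Kˣ) (a : K) (B : Matrix (Fin n') (Fin n') K), StrictUpper B ∧
      e.boundary 1 (rulingMatrix σ u) = 0 ∧
      e.outgoing a (sgn (e.degree μ)) 1 (rulingMatrix σ u) * (1 + B) =
        signMatrix K μ' * (1 + B) * signMatrix K μ' * rulingMatrix σ' 1 := by
  have unchanged {A : Matrix (Fin n') (Fin n') K} (hA : A = rulingMatrix σ' 1) :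
      A * (1 + 0) = signMatrix K μ' * (1 + 0) * signMatrix K μ' * rulingMatrix σ' 1 := by
    rw [hA, add_zero, mul_one, mul_one, signMatrix_mul_self, one_mul]
  cases e with
  | trivial => exact ⟨1, 0, 0, .zero, rfl, unchanged (congrArg (rulingMatrix · 1) h.symm)⟩
  | crossing n k =>
    obtain ⟨hne, rfl | ⟨rfl, hN⟩⟩ := h
    · exact ⟨1, 0, 0, .zero, if_neg fun h => hne h.2,
        unchanged (outgoing_crossing_rulingMatrix hne hσ _ _)⟩
    · obtain ⟨u, B, hB, hout⟩ := exists_outgoing_switch hne hσ hN (fun i => hμ i _ rfl) (1 : K)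
      exact ⟨u, 1, B, hB, if_neg fun h => hne h.2, hout⟩
  | leftCusp n k =>
    exact ⟨1, 0, 0, .zero, rfl, unchanged (outgoing_leftCusp_rulingMatrix h.1 h.2 hσ' _ _ _)⟩
  | rightCusp n k =>
    refine ⟨negAt K k.castSucc, 0, 0, .zero, ?_,
      unchanged (outgoing_rightCusp_rulingMatrix h.1 h.2 _ _)⟩
    change 1 + rulingMatrix σ (negAt K k.castSucc) k.castSucc k.succ = 0
    rw [rulingMatrix_apply, if_pos ⟨Fin.castSucc_lt_succ, h.1⟩, negAt, Function.update_self,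
      Units.val_neg, Units.val_one, add_neg_cancel]

end RulingStep

end Event

end SolidTorus

namespace SolidTorus

namespace Event

variable {n n' : ℕ} {e : Event n n'}

theorem Through.eq_iff_eq {i i' : Fin n} {j j' : Fin n'} (h : e.Through i j)
    (h' : e.Through i' j') : i = i' ↔ j = j' := by
  cases e with
  | trivial => rw [show j = i from h, show j' = i' from h']
  | crossing n k =>
    rw [show j = transp k i from h, show j' = transp k i' from h', (transp k).injective.eq_iff]
  | leftCusp n k =>
    rw [show j = skip k i from h, show j' = skip k i' from h', (skip_injective k).eq_iff]
  | rightCusp n k =>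
    rw [show i = skip k j from h, show i' = skip k j' from h', (skip_injective k).eq_iff]

theorem LeftCuspAt.ne {i j : Fin n'} (h : e.LeftCuspAt i j) : i ≠ j := by
  cases e <;> obtain ⟨rfl, rfl⟩ := h
  exact Fin.castSucc_lt_succ.ne

theorem RightCuspAt.ne {i j : Fin n} (h : e.RightCuspAt i j) : i ≠ j := by
  cases e <;> obtain ⟨rfl, rfl⟩ := h
  exact Fin.castSucc_lt_succ.ne

theorem LeftCuspAt.unique {i j i' j' : Fin n'} (h : e.LeftCuspAt i j)
    (h' : e.LeftCuspAt i' j') : i = i' ∧ j = j' := by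
  cases e <;> obtain ⟨rfl, rfl⟩ := h
  exact ⟨h'.1.symm, h'.2.symm⟩

theorem RightCuspAt.unique {i j i' j' : Fin n} (h : e.RightCuspAt i j)
    (h' : e.RightCuspAt i' j') : i = i' ∧ j = j' := by
  cases e <;> obtain ⟨rfl, rfl⟩ := h
  exact ⟨h'.1.symm, h'.2.symm⟩

theorem Through.ne_of_leftCuspAt {i : Fin n} {j p q : Fin n'} (h : e.Through i j)
    (h' : e.LeftCuspAt p q) : j ≠ p ∧ j ≠ q := by
  cases e <;> cases h'
  cases h
  subst_vars
  exact ⟨skip_ne_castSucc _ i, skip_ne_succ _ i⟩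

theorem Through.ne_of_rightCuspAt {i p q : Fin n} {j : Fin n'} (h : e.Through i j)
    (h' : e.RightCuspAt p q) : i ≠ p ∧ i ≠ q := by
  cases e <;> cases h'
  cases h
  subst_vars
  exact ⟨skip_ne_castSucc _ j, skip_ne_succ _ j⟩

end Event

namespace Front

/-! ### Gauge transformations -/

section Gauge

/-- The coefficients that the base points put on the link: one on every strand, and one on the loop
of every right cusp. The second component is also indexed by the events that are not right cusps;
there it plays no role. -/
abbrev Coeffs (D : Front) (K : Type) [CommRing K] : Type :=
  (D.Strand → Kˣ) × (Fin (D.M + 1) → Kˣ)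

variable {D : Front} {K : Type} [CommRing K] {r : ℕ} {μ : D.MaslovPotential r}

/-- The values of an augmentation on the generators of the dipped diagram, arranged in matrices, if
the base points have the coefficients `x`. The equations say that the augmentation vanishes on the
differentials of the generators. -/
structure MatrixAugmentation (μ : D.MaslovPotential r) (x : D.Coeffs K) where
  a : Fin (D.M + 1) → K
  B : (m : Fin (D.M + 1)) → Matrix (Fin (D.N (m + 1))) (Fin (D.N (m + 1))) K
  C : (m : Fin (D.M + 1)) → Matrix (Fin (D.N m)) (Fin (D.N m)) K
  strictUpper_B : ∀ m, StrictUpper (B m)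
  strictUpper_C : ∀ m, StrictUpper (C m)
  boundary_eq_zero : ∀ m,
    (D.event m).boundary (x.2 m : K) (diagConj (fun i => x.1 ⟨m, i⟩) (C m)) = 0
  outgoing_mul : ∀ m,
    (D.event m).outgoing (a m) (sgn ((D.event m).degree (μ.val m))) ↑(x.2 m)⁻¹
        (diagConj (fun i => x.1 ⟨m, i⟩) (C m)) * (1 + B m) =
      signMatrix K (μ.val (m + 1)) * (1 + B m) * signMatrix K (μ.val (m + 1)) * C (m + 1)
  sq_eq_zero : ∀ m, (signMatrix K (μ.val m) * C m) ^ 2 = 0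

/-- `g` exhibits `x` as a gauge transformation: multiplying the coefficients by `x` has the same
effect as conjugating the matrices `C` of the dips by the diagonal matrices with entries `g`. -/
structure IsGauge (x : D.Coeffs K) (g : D.Strand → Kˣ) : Prop where
  through : ∀ m i j, (D.event m).Through i j → x.1 ⟨m, i⟩ * g ⟨m, i⟩ = g ⟨m + 1, j⟩
  left : ∀ m i j, (D.event m).LeftCuspAt i j → g ⟨m + 1, i⟩ = g ⟨m + 1, j⟩
  right : ∀ m i j, (D.event m).RightCuspAt i j →
    x.1 ⟨m, j⟩ * g ⟨m, j⟩ = x.2 m * (x.1 ⟨m, i⟩ * g ⟨m, i⟩)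

/-- The group of the coefficients that gauge transformations remove. -/
def gaugeSubgroup (D : Front) (K : Type) [CommRing K] : Subgroup (D.Coeffs K) where
  carrier := {x | ∃ g, IsGauge x g}
  one_mem' := ⟨1, by constructor <;> simp⟩
  mul_mem' := by
    rintro x y ⟨g, hg⟩ ⟨h, hh⟩
    refine ⟨g * h, fun m i j e => ?_, fun m i j e => ?_, fun m i j e => ?_⟩
    · simp only [Prod.fst_mul, Pi.mul_apply]
      rw [mul_mul_mul_comm, hg.through m i j e, hh.through m i j e]
    · simp only [Pi.mul_apply]
      rw [hg.left m i j e, hh.left m i j e]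
    · simp only [Prod.fst_mul, Prod.snd_mul, Pi.mul_apply]
      rw [mul_mul_mul_comm, hg.right m i j e, hh.right m i j e, mul_mul_mul_comm,
        mul_mul_mul_comm (x.1 _)]
  inv_mem' := by
    rintro x ⟨g, hg⟩
    refine ⟨g⁻¹, fun m i j e => ?_, fun m i j e => ?_, fun m i j e => ?_⟩
    · simp only [Prod.fst_inv, Pi.inv_apply]
      rw [← mul_inv, hg.through m i j e]
    · simp only [Pi.inv_apply]
      rw [hg.left m i j e]
    · simp only [Prod.fst_inv, Prod.snd_inv, Pi.inv_apply]
      rw [← mul_inv, hg.right m i j e, mul_inv, mul_inv]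

theorem IsGauge.nonempty_matrixAugmentation {x y : D.Coeffs K} {g : D.Strand → Kˣ}
    (hg : IsGauge y g) (h : Nonempty (MatrixAugmentation μ x)) :
    Nonempty (MatrixAugmentation μ (x * y)) := by
  obtain ⟨X⟩ := h
  have conj (m : Fin (D.M + 1)) :
      diagConj (fun i => (x * y).1 ⟨m, i⟩) (diagConj (fun i => g ⟨m, i⟩) (X.C m)) =
        diagConj (fun i => y.1 ⟨m, i⟩ * g ⟨m, i⟩) (diagConj (fun i => x.1 ⟨m, i⟩) (X.C m)) := by
    rw [diagConj_diagConj, diagConj_diagConj]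
    refine congrArg (diagConj · (X.C m)) (funext fun i => ?_)
    change x.1 _ * y.1 _ * g _ = y.1 _ * g _ * x.1 _
    rw [mul_assoc, mul_comm]
  have conj_signMatrix (m : Fin (D.M + 1)) :
      diagConj (fun i => g ⟨m, i⟩) (signMatrix K (μ.val m)) = signMatrix K (μ.val m) :=
    diagConj_diagonal _ _
  choose a ha using fun m => Event.exists_outgoing_diagConj (hg.through m) (hg.left m) (hg.right m)
    (X.a m) (sgn ((D.event m).degree (μ.val m))) ↑(x.2 m)⁻¹ (diagConj (fun i => x.1 ⟨m, i⟩) (X.C m))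
  refine ⟨a, fun m => diagConj (fun i => g ⟨m + 1, i⟩) (X.B m),
    fun m => diagConj (fun i => g ⟨m, i⟩) (X.C m), fun m => (X.strictUpper_B m).diagConj _,
    fun m => (X.strictUpper_C m).diagConj _, fun m => ?_, fun m => ?_, fun m => ?_⟩
  · rw [conj, Prod.snd_mul, Pi.mul_apply, Units.val_mul]
    exact Event.boundary_diagConj_eq_zero (hg.right m) (X.boundary_eq_zero m)
  · have h := congrArg (diagConj fun i => g ⟨m + 1, i⟩) (X.outgoing_mul m)
    simp only [map_mul, map_add, map_one, conj_signMatrix] at h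
    rw [conj, ← h, ← ha, Prod.snd_mul, Pi.mul_apply, mul_comm (x.2 m), mul_inv,
      Units.val_mul]
  · rw [← conj_signMatrix, ← map_mul, ← map_pow, X.sq_eq_zero, map_zero]

theorem IsGauge.mk_eq_mk {x y z : D.Coeffs K} {g : D.Strand → Kˣ} (hg : IsGauge z g)
    (hz : x⁻¹ * y = z) : (x : D.Coeffs K ⧸ D.gaugeSubgroup K) = y :=
  QuotientGroup.eq.mpr ⟨g, hz ▸ hg⟩

theorem nonempty_matrixAugmentation_of_mk_eq {x y : D.Coeffs K}
    (hxy : (x : D.Coeffs K ⧸ D.gaugeSubgroup K) = y) (h : Nonempty (MatrixAugmentation μ x)) :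
    Nonempty (MatrixAugmentation μ y) := by
  obtain ⟨g, hg⟩ := QuotientGroup.eq.mp hxy
  rw [← mul_inv_cancel_left x y]
  exact hg.nonempty_matrixAugmentation h

end Gauge

/-! ### Sliding coefficients along the link -/

section Slide

variable {D : Front} {K : Type} [CommRing K] {r : ℕ} (μ : D.MaslovPotential r)

/-- The coefficients of a single base point of value `c` at a site. -/
def siteCoeffs : D.Site → Kˣ →* D.Coeffs K
  | .strand m i => (MonoidHom.inl _ _).comp
      ((MonoidHom.mulSingle (fun _ : D.Strand => Kˣ) ⟨m, i⟩).comp (zpowGroupHom (sgn (μ.val m i))))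
  | .loop m i _ _ => (MonoidHom.inr _ _).comp
      ((MonoidHom.mulSingle (fun _ => Kˣ) m).comp (zpowGroupHom (sgn (μ.val m i))))

theorem isGauge_of_through {m : Fin (D.M + 1)} {i : Fin (D.N m)} {j : Fin (D.N (m + 1))}
    (h : (D.event m).Through i j) (d : Kˣ) :
    IsGauge (D := D) ((Pi.mulSingle ⟨m + 1, j⟩ d)⁻¹ * Pi.mulSingle ⟨m, i⟩ d, 1)
      (Pi.mulSingle ⟨m + 1, j⟩ d) where
  through m' i' j' h' := by
    simp only [Pi.mul_apply, Pi.inv_apply, inv_mul_cancel_comm]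
    rcases eq_or_ne m' m with rfl | hm
    · simp [Pi.mulSingle_apply, h'.eq_iff_eq h]
    · simp [hm]
  left m' i' j' h' := by
    rcases eq_or_ne m' m with rfl | hm
    · have := h.ne_of_leftCuspAt h'
      simp [this.1.symm, this.2.symm]
    · simp [hm]
  right m' i' j' h' := by
    simp only [Pi.mul_apply, Pi.inv_apply, inv_mul_cancel_comm]
    rcases eq_or_ne m' m with rfl | hm
    · have := h.ne_of_rightCuspAt h'
      simp [this.1.symm, this.2.symm]
    · simp [hm]

theorem isGauge_of_leftCuspAt {m : Fin (D.M + 1)} {i j : Fin (D.N (m + 1))}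
    (h : (D.event m).LeftCuspAt i j) (d : Kˣ) :
    IsGauge (D := D) (Pi.mulSingle ⟨m + 1, i⟩ d * Pi.mulSingle ⟨m + 1, j⟩ d, 1)
      (Pi.mulSingle ⟨m + 1, i⟩ d * Pi.mulSingle ⟨m + 1, j⟩ d)⁻¹ where
  through m' i' j' h' := by
    rcases eq_or_ne m' m with rfl | hm
    · have := h'.ne_of_leftCuspAt h
      simp [this.1, this.2]
    · simp [hm]
  left m' i' j' h' := by
    rcases eq_or_ne m' m with rfl | hm
    · obtain ⟨rfl, rfl⟩ := h.unique h'
      simp [h.ne, h.ne.symm]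
    · simp [hm]
  right m' i' j' _ := by simp

theorem isGauge_of_rightCuspAt {m : Fin (D.M + 1)} {i j : Fin (D.N m)}
    (h : (D.event m).RightCuspAt i j) (d : Kˣ) :
    IsGauge (D := D) (Pi.mulSingle ⟨m, i⟩ d * Pi.mulSingle ⟨m, j⟩ d, 1) 1 where
  through m' i' j' h' := by
    rcases eq_or_ne m' m with rfl | hm
    · have := h'.ne_of_rightCuspAt h
      simp [this.1, this.2]
    · simp [hm]
  left m' i' j' _ := rfl
  right m' i' j' h' := by
    rcases eq_or_ne m' m with rfl | hm
    · obtain ⟨rfl, rfl⟩ := h.unique h'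
      simp [h.ne, h.ne.symm]
    · simp [hm]

theorem isGauge_loop {m : Fin (D.M + 1)} {i j : Fin (D.N m)}
    (h : (D.event m).RightCuspAt i j) (d : Kˣ) :
    IsGauge (D := D) ((Pi.mulSingle ⟨m, i⟩ d)⁻¹, Pi.mulSingle m d) 1 where
  through m' i' j' h' := by
    rcases eq_or_ne m' m with rfl | hm
    · have := h'.ne_of_rightCuspAt h
      simp [this.1]
    · simp [hm]
  left m' i' j' _ := rfl
  right m' i' j' h' := by
    rcases eq_or_ne m' m with rfl | hm
    · obtain ⟨rfl, rfl⟩ := h.unique h'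
      simp [h.ne.symm]
    · simp [hm]

theorem mk_siteCoeffs_eq_of_adj {p q : D.Strand} (h : D.Adj p q) (c : Kˣ) :
    (siteCoeffs μ (.strand p.1 p.2) c : D.Coeffs K ⧸ D.gaugeSubgroup K) =
      siteCoeffs μ (.strand q.1 q.2) c := by
  cases h with
  | through m i j h =>
    refine ((isGauge_of_through h (c ^ sgn (μ.val m i))).mk_eq_mk ?_).symm
    simp [siteCoeffs, μ.through m i j h]
  | left m i j h =>
    refine (isGauge_of_leftCuspAt h (c ^ sgn (μ.val (m + 1) j))).mk_eq_mk ?_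
    simp [siteCoeffs, μ.left m i j h, sgn_add_one, Pi.mulSingle_inv]
  | right m i j h =>
    refine (isGauge_of_rightCuspAt h (c ^ sgn (μ.val m j))).mk_eq_mk ?_
    simp [siteCoeffs, μ.right m i j h, sgn_add_one, Pi.mulSingle_inv]

theorem mk_siteCoeffs_eq_of_sameComponent {p q : D.Strand} (h : D.SameComponent p q) (c : Kˣ) :
    (siteCoeffs μ (.strand p.1 p.2) c : D.Coeffs K ⧸ D.gaugeSubgroup K) =
      siteCoeffs μ (.strand q.1 q.2) c := by
  induction h with
  | rel p q h => exact mk_siteCoeffs_eq_of_adj μ h c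
  | refl p => rfl
  | symm p q _ ih => exact ih.symm
  | trans p q l _ _ ih ih' => exact ih.trans ih'

theorem mk_siteCoeffs_toStrand (S : D.Site) (c : Kˣ) :
    (siteCoeffs μ (.strand S.toStrand.1 S.toStrand.2) c : D.Coeffs K ⧸ D.gaugeSubgroup K) =
      siteCoeffs μ S c := by
  cases S with
  | strand m i => rfl
  | loop m i j h =>
    refine (isGauge_loop h (c ^ sgn (μ.val m i))).mk_eq_mk ?_
    simp [siteCoeffs, Site.toStrand]

/-- The coefficients of the base points `P` with the values `u`. -/
def baseCoeffs {s : ℕ} (P : D.BasePoints s) (u : Fin s → Kˣ) : D.Coeffs K :=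
  ∏ q, siteCoeffs μ (P.pos q) (u q)

theorem exists_mk_baseCoeffs_eq {s : ℕ} (P : D.BasePoints s) (t : D.Strand → Kˣ) :
    ∃ u : Fin s → Kˣ, ∏ q, u q = ∏ p, t p ^ sgn (μ.val p.1 p.2) ∧
      (baseCoeffs μ P u : D.Coeffs K ⧸ D.gaugeSubgroup K) = ((t, 1) : D.Coeffs K) := by
  choose b hb using P.exists_mem
  let w (p : D.Strand) : Kˣ := t p ^ sgn (μ.val p.1 p.2)
  have slide (p : D.Strand) :
      (siteCoeffs μ (P.pos (b p)) (w p) : D.Coeffs K ⧸ D.gaugeSubgroup K) =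
        siteCoeffs μ (.strand p.1 p.2) (w p) := by
    rw [mk_siteCoeffs_eq_of_sameComponent μ (hb p), mk_siteCoeffs_toStrand]
  have strand (p : D.Strand) :
      siteCoeffs μ (.strand p.1 p.2) (w p) = (Pi.mulSingle p (t p), 1) := by
    simp [siteCoeffs, w, ← zpow_mul, sgn_mul_self]
  refine ⟨fun q => ∏ p with b p = q, w p, Finset.prod_fiberwise _ _ _, ?_⟩
  calc (baseCoeffs μ P fun q => ∏ p with b p = q, w p : D.Coeffs K ⧸ D.gaugeSubgroup K)
      = ∏ q, ∏ p with b p = q,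
          (siteCoeffs μ (P.pos (b p)) (w p) : D.Coeffs K ⧸ D.gaugeSubgroup K) := by
        rw [baseCoeffs, QuotientGroup.mk_prod]
        refine Finset.prod_congr rfl fun q _ => ?_
        rw [map_prod, QuotientGroup.mk_prod]
        exact Finset.prod_congr rfl fun p hp => by rw [(Finset.mem_filter.mp hp).2]
    _ = ∏ p, (siteCoeffs μ (.strand p.1 p.2) (w p) : D.Coeffs K ⧸ D.gaugeSubgroup K) := by
        rw [Finset.prod_fiberwise]
        exact Finset.prod_congr rfl fun p _ => slide p
    _ = ((t, 1) : D.Coeffs K) := by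
        simp only [strand, ← QuotientGroup.mk_prod]
        congr 1
        ext1
        · simp [Prod.fst_prod, Finset.univ_prod_mulSingle]
        · simp [Prod.snd_prod]

end Slide

section Ruling

variable {D : Front} {r : ℕ} {μ : D.MaslovPotential r}

theorem GeneralizedNormalRuling.exists_forall_nonempty_matrixAugmentation
    (R : D.GeneralizedNormalRuling) (K : Type) [CommRing K] :
    ∃ t₀ : D.Strand → Kˣ, ∀ t : D.Strand → Kˣ, (∀ p, R.σ p.1 p.2 ≠ p.2 → t p = t₀ p) →
      Nonempty (MatrixAugmentation μ (t, 1)) := by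
  choose u a B hB boundary outgoing using fun m =>
    (R.step m).exists_outgoing (K := K) (R.involutive m) (R.involutive (m + 1)) (μ.through m)
  choose t₀ ht₀ using fun m => exists_diagConj_rulingMatrix_eq (R.involutive m) 1 (u m)
  refine ⟨fun p => t₀ p.1 p.2, fun t ht => ?_⟩
  have conj (m : Fin (D.M + 1)) :
      diagConj (fun i => t ⟨m, i⟩) (rulingMatrix (R.σ m) 1) = rulingMatrix (R.σ m) (u m) := by
    rw [← ht₀]
    exact diagConj_rulingMatrix_congr (R.involutive m) 1 fun i hi => ht ⟨m, i⟩ hi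
  refine ⟨a, B, fun m => rulingMatrix (R.σ m) 1, hB, fun m => strictUpper_rulingMatrix _ _,
    fun m => ?_, fun m => ?_, fun m => ?_⟩
  · rw [conj]
    exact boundary m
  · rw [conj]
    simpa only [Pi.one_apply, inv_one, Units.val_one] using outgoing m
  · rw [signMatrix_mul_rulingMatrix, sq, rulingMatrix_mul_self (R.involutive m)]

/-- The coefficient of a self-paired strand is free, and it adjusts the product. -/
theorem GeneralizedNormalRuling.IsStrict.exists_matrixAugmentation {R : D.GeneralizedNormalRuling}
    (hR : R.IsStrict) {K : Type} [CommRing K] (x : Kˣ) :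
    ∃ t : D.Strand → Kˣ, ∏ p, t p ^ sgn (μ.val p.1 p.2) = x ∧
      Nonempty (MatrixAugmentation μ (t, 1)) := by
  obtain ⟨m, i, hi⟩ := hR
  obtain ⟨t₀, ht₀⟩ := R.exists_forall_nonempty_matrixAugmentation (μ := μ) K
  let y : Kˣ := (x / ∏ p, t₀ p ^ sgn (μ.val p.1 p.2)) ^ sgn (μ.val m i)
  refine ⟨t₀ * Pi.mulSingle ⟨m, i⟩ y, ?_, ht₀ _ fun p hp => ?_⟩
  · have single : ∏ p : D.Strand, (Pi.mulSingle ⟨m, i⟩ y : D.Strand → Kˣ) p ^ sgn (μ.val p.1 p.2) =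
        y ^ sgn (μ.val m i) := by
      rw [Fintype.prod_eq_single ⟨m, i⟩ fun p hp => by
        rw [Pi.mulSingle_eq_of_ne hp, one_zpow], Pi.mulSingle_eq_same]
    simp only [Pi.mul_apply, mul_zpow, Finset.prod_mul_distrib, single]
    rw [← zpow_mul, sgn_mul_self, zpow_one, mul_div_cancel]
  · have hne : p ≠ ⟨m, i⟩ := fun h => hp (by rw [h]; exact hi)
    rw [Pi.mul_apply, Pi.mulSingle_eq_of_ne hne, mul_one]

theorem GeneralizedNormalRuling.IsStrict.exists_matrixAugmentation_baseCoeffs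
    {R : D.GeneralizedNormalRuling} (hR : R.IsStrict) {s : ℕ} (P : D.BasePoints s) {K : Type}
    [CommRing K] (x : Kˣ) :
    ∃ u : Fin s → Kˣ, ∏ q, u q = x ∧ Nonempty (MatrixAugmentation μ (baseCoeffs μ P u)) := by
  obtain ⟨t, rfl, ht⟩ := hR.exists_matrixAugmentation (μ := μ) x
  obtain ⟨u, hu, hut⟩ := exists_mk_baseCoeffs_eq μ P t
  exact ⟨u, hu, nonempty_matrixAugmentation_of_mk_eq hut.symm ht⟩

end Ruling

end Front

/-! ### Evaluation -/

section LaurentEval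

variable {s : ℕ} {K : Type*} [CommRing K]

/-- The evaluation of Laurent polynomials at the units `u`. -/
noncomputable def laurentEval (u : Fin s → Kˣ) : Laurent s →+* K :=
  (AddMonoidAlgebra.lift ℤ K (Fin s → ℤ)
    { toFun := fun v => ((∏ q, u q ^ v.toAdd q : Kˣ) : K)
      map_one' := by simp
      map_mul' := fun v w => by
        simp only [toAdd_mul, Pi.add_apply, zpow_add, Finset.prod_mul_distrib,
          Units.val_mul] }).toRingHom

theorem laurentEval_mono (u : Fin s → Kˣ) (v : Fin s → ℤ) :
    laurentEval u (mono v) = (∏ q, u q ^ v q : Kˣ) := by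
  simp [laurentEval, mono, AddMonoidAlgebra.lift_single]

theorem laurentEval_tVar (u : Fin s → Kˣ) (q : Fin s) : laurentEval u (tVar q) = u q := by
  rw [tVar, laurentEval_mono, Fintype.prod_eq_single q fun q' h => by
    rw [Pi.single_eq_of_ne h, zpow_zero], Pi.single_eq_same, zpow_one]

end LaurentEval

section FreeAlgebraEval

variable {R X : Type} [CommRing R] {K : Type*} [CommRing K]

/-- The ring homomorphism from the free algebra that restricts to `φ` on the coefficients and to `f`
on the generators. -/
noncomputable def freeAlgebraEval (φ : R →+* K) (f : X → K) : FreeAlgebra R X →+* K :=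
  letI := φ.toAlgebra
  (FreeAlgebra.lift R f).toRingHom

theorem freeAlgebraEval_ι (φ : R →+* K) (f : X → K) (g : X) :
    freeAlgebraEval φ f (FreeAlgebra.ι R g) = f g :=
  letI := φ.toAlgebra
  FreeAlgebra.lift_ι_apply f g

theorem freeAlgebraEval_algebraMap (φ : R →+* K) (f : X → K) (c : R) :
    freeAlgebraEval φ f (algebraMap R _ c) = φ c :=
  letI := φ.toAlgebra
  (FreeAlgebra.lift R f).commutes c

theorem map_extend_eq_zero (ε : FreeAlgebra R X →+* K) {sg : X → ℤ} {d : X → FreeAlgebra R X}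
    (h : ∀ g, ε (d g) = 0) (y : FreeAlgebra R X) : ε (extend sg d y) = 0 := by
  induction y using FreeAlgebra.induction with
  | grade0 c => rw [extend_algebraMap, map_zero]
  | grade1 g => rw [extend_ι, h]
  | mul y z hy hz =>
    rw [extend_mul, map_add, map_mul, map_mul, hy, hz, zero_mul, mul_zero, add_zero]
  | add y z hy hz => rw [extend_add, map_add, hy, hz, add_zero]

end FreeAlgebraEval

namespace Front

section Augmentation

variable {D : Front} {r s : ℕ} {μ : D.MaslovPotential r} {P : D.BasePoints s} {K : Type}
  [CommRing K] (u : Fin s → Kˣ)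

theorem baseCoeffs_fst (m : Fin (D.M + 1)) (i : Fin (D.N m)) :
    (baseCoeffs μ P u).1 ⟨m, i⟩ = ∏ q, u q ^ strandExp μ P m i q := by
  rw [baseCoeffs, Prod.fst_prod, Finset.prod_apply]
  refine Finset.prod_congr rfl fun q _ => ?_
  rw [strandExp]
  generalize P.pos q = S
  cases S with
  | loop m' i' j' h => simp [siteCoeffs]
  | strand m' i' =>
    by_cases h : (⟨m, i⟩ : D.Strand) = ⟨m', i'⟩
    · cases h
      simp [siteCoeffs]
    · have hS : Site.strand m' i' ≠ Site.strand m i := fun h' => h (by cases h'; rfl)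
      simp [siteCoeffs, Pi.mulSingle_eq_of_ne h, hS]

theorem baseCoeffs_snd (m : Fin (D.M + 1)) :
    (baseCoeffs μ P u).2 m = ∏ q, u q ^ loopExp μ P m q := by
  rw [baseCoeffs, Prod.snd_prod, Finset.prod_apply]
  refine Finset.prod_congr rfl fun q _ => ?_
  rw [loopExp]
  generalize P.pos q = S
  cases S with
  | strand m' i' => simp [siteCoeffs]
  | loop m' i' j' h =>
    rcases eq_or_ne m' m with rfl | hm
    · simp [siteCoeffs]
    · simp [siteCoeffs, hm]

variable {u}

/-- The augmentation with the values recorded in `X`. -/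
noncomputable def MatrixAugmentation.eval (X : MatrixAugmentation μ (baseCoeffs μ P u)) :
    D.Alg s →+* K :=
  freeAlgebraEval (laurentEval u) fun
    | .a m _ => X.a m
    | .b m i j _ => X.B m i j
    | .c m i j _ => X.C m i j

namespace MatrixAugmentation

variable (X : MatrixAugmentation μ (baseCoeffs μ P u)) (m : Fin (D.M + 1))

theorem eval_algebraMap (f : Laurent s) : X.eval (algebraMap _ _ f) = laurentEval u f :=
  freeAlgebraEval_algebraMap _ _ f

theorem map_matB : (D.matB s m).map X.eval = X.B m := by
  ext i j
  rw [Matrix.map_apply, matB]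
  split_ifs with h
  · exact freeAlgebraEval_ι _ _ _
  · rw [map_zero, X.strictUpper_B m h]

theorem map_matC : (D.matC s m).map X.eval = X.C m := by
  ext i j
  rw [Matrix.map_apply, matC]
  split_ifs with h
  · exact freeAlgebraEval_ι _ _ _
  · rw [map_zero, X.strictUpper_C m h]

theorem map_matSigma : (matSigma μ s m).map X.eval = signMatrix K (μ.val m) := by
  rw [matSigma, Matrix.diagonal_map (map_zero _)]
  simp only [map_intCast]
  rfl

theorem map_basedC : (basedC μ P m).map X.eval =
    diagConj (fun i => (baseCoeffs μ P u).1 ⟨m, i⟩) (X.C m) := by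
  ext i j
  rw [Matrix.map_apply, basedC, Algebra.smul_def, map_mul, X.eval_algebraMap, laurentEval_mono,
    ← Matrix.map_apply (f := X.eval), X.map_matC, diagConj_apply, baseCoeffs_fst, baseCoeffs_fst]
  simp only [Pi.sub_apply, zpow_sub, Finset.prod_mul_distrib, Finset.prod_inv_distrib,
    Units.val_mul]
  ring

theorem map_tildeC : (tildeC μ P m).map X.eval =
    (D.event m).outgoing (X.a m) (sgn ((D.event m).degree (μ.val m))) ↑((baseCoeffs μ P u).2 m)⁻¹
      (diagConj (fun i => (baseCoeffs μ P u).1 ⟨m, i⟩) (X.C m)) := by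
  have eval_loop : X.eval (algebraMap _ _ (mono (-loopExp μ P m))) =
      ↑((baseCoeffs μ P u).2 m)⁻¹ := by
    rw [X.eval_algebraMap, laurentEval_mono, baseCoeffs_snd]
    simp only [Pi.neg_apply, zpow_neg, Finset.prod_inv_distrib]
  rw [tildeC, Event.map_outgoing, eval_loop, X.map_basedC]
  refine Event.outgoing_congr (fun h => ?_) _ _ _
  rw [aGen, dif_pos h]
  exact freeAlgebraEval_ι _ _ _

theorem eval_diffGen (g : D.Gen) : X.eval (diffGen μ P g) = 0 := by
  cases g with
  | a m h =>
    rw [diffGen, Event.map_boundary, X.map_basedC, X.eval_algebraMap, laurentEval_mono,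
      ← baseCoeffs_snd, X.boundary_eq_zero]
  | b m i j h =>
    rw [diffGen, ← Matrix.map_apply (f := X.eval)]
    simp only [← RingHom.mapMatrix_apply, map_add, map_neg, map_mul, map_one]
    simp only [RingHom.mapMatrix_apply, X.map_matSigma, X.map_matB, X.map_matC, X.map_tildeC]
    rw [X.outgoing_mul, neg_add_cancel, Matrix.zero_apply]
  | c m i j h =>
    rw [diffGen, ← Matrix.map_apply (f := X.eval), ← RingHom.mapMatrix_apply, map_pow, map_mul,
      RingHom.mapMatrix_apply, RingHom.mapMatrix_apply, X.map_matSigma, X.map_matC, X.sq_eq_zero,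
      Matrix.zero_apply]

theorem eval_diff (y : D.Alg s) : X.eval (diff μ P y) = 0 :=
  map_extend_eq_zero X.eval X.eval_diffGen y

end MatrixAugmentation

end Augmentation

section Existence

variable {D : Front} {r s : ℕ} (μ : D.MaslovPotential r) (P : D.BasePoints s)

theorem GeneralizedNormalRuling.IsStrict.exists_eval_diff_eq_zero {R : D.GeneralizedNormalRuling}
    (hR : R.IsStrict) {K : Type} [CommRing K] (x : Kˣ) :
    ∃ ε : D.Alg s →+* K, (∀ y, ε (diff μ P y) = 0) ∧
      ε (algebraMap (Laurent s) (D.Alg s) (∏ q, tVar q)) = x := by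
  obtain ⟨u, rfl, ⟨X⟩⟩ := hR.exists_matrixAugmentation_baseCoeffs (μ := μ) P x
  refine ⟨X.eval, X.eval_diff, ?_⟩
  simp only [X.eval_algebraMap, map_prod, laurentEval_tVar, Units.coe_prod]

end Existence

end Front

end SolidTorus

open LaurentPolynomial in
/-- The case of `ℤ[T;T⁻¹]` and `x = T` is universal. -/
theorem mainTheorem8_general (D : SolidTorus.Front) (r : ℕ) (μ : D.MaslovPotential r)
    (s : ℕ) (P : D.BasePoints s)
    (R : D.GeneralizedNormalRuling) (hR : R.IsStrict)
    {K : Type*} [CommRing K] (x : Kˣ) :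
    ∃ ε : D.Alg s →+* K, (∀ y, ε (SolidTorus.Front.diff μ P y) = 0) ∧
      ε (algebraMap (SolidTorus.Laurent s) (D.Alg s) (∏ q : Fin s, SolidTorus.tVar q)) = x := by
  obtain ⟨ε, hε, hεt⟩ := hR.exists_eval_diff_eq_zero (K := ℤ[T;T⁻¹]) μ P
    ⟨T 1, T (-1), by rw [← T_add, add_neg_cancel, T_zero], by rw [← T_add, neg_add_cancel, T_zero]⟩
  refine ⟨(eval₂ (Int.castRingHom K) x).comp ε, fun y => ?_, ?_⟩
  · rw [RingHom.comp_apply, hε, map_zero]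
  · rw [RingHom.comp_apply, hεt, eval₂_T, zpow_one]

theorem mainTheorem8 (D : SolidTorus.Front) (r : ℕ) (μ : D.MaslovPotential r)
    (s : ℕ) (P : D.BasePoints s)
    (R : D.GeneralizedNormalRuling) (hR : R.IsStrict)
    {F : Type*} [Field F] (x : F) (hx : x ≠ 0) :
    ∃ ε : D.Alg s →+* F, SolidTorus.Front.IsAugmentation μ P ε ∧
      ε (algebraMap (SolidTorus.Laurent s) (D.Alg s) (∏ q : Fin s, SolidTorus.tVar q)) = x :=
  mainTheorem8_general D r μ s P R hR (Units.mk0 x hx)
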